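/- **Setting.** A hidden semi-Markov model (HSMM) has latent states $x_t\in\{1,\dots,n_x\}$, duration counters $d_t\in\{1,\dots,n_d\}$ and observations $o_t\in\{1,\dots,n_o\}$. Its parameters are column-stochastic matrices $D=p(d_t|x_t,d_{t-1}=1)$, $X=p(x_t|x_{t-1},d_{t-1}=1)$, $O=p(o_t|x_t)$ and a prior law of $(x_0,d_0)$. If $d_{t-1}=1$, then $x_t$ is drawn from $X(\cdot|x_{t-1})$ and $d_t$ from $D(\cdot|x_t)$; if $d_{t-1}>1$, then $x_t=x_{t-1}$ and $d_t=d_{t-1}-1$; for $t\ge1$, $o_t$ is drawn from $O(\cdot|x_t)$. Assume (A1) $X$ has rank $n_x$ and $X(y|x)>0$ for $y\ne x$; (A2) all entries of $D$ are positive; (A3) $O$ has rank $n_x$. Fix finite sets $L,R\subset\{0,1,2,\dots\}$ of offsets and put $O_{R_t}=(o_{t+1+i})_{i\in R}$ and $O_{L_t}=(o_{t-1-i})_{i\in L}$. We say that $O_{L_t}$ *exists* if $t-1-i\ge1$ for all $i\in L$. Conditional distributions and joint distributions are regarded as matrices, the observed values in a window indexing the rows of $F_{R_t|x_td_{t-1}}=p(O_{R_t}|x_t,d_{t-1})$,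 $F_{R_t|x_{t-1}d_{t-1}}=p(O_{R_t}|x_{t-1},d_{t-1})$ and $F_{L_t|x_td_{t-1}}=p(O_{L_t}|x_t,d_{t-1})$. (A column conditioned on a null event is set to $0$, so that the rank conditions below include the positivity of the conditioning probabilities.) $A^{-1}$ denotes the Moore–Penrose inverse, which is a left inverse if $A$ has full column rank. **Rank condition on the right windows.** For every $t\ge2$, $\operatorname{rank}F_{R_t|x_td_{t-1}}=n_xn_d$. **Transformed tensors.** For $t\ge3$, with summation over the latent variables, $$\tilde D_t(q,r)=\sum_{x,d}F^{-1}_{R_{t-1}|x_{t-1}d_{t-2}}\big((x,d),q\big)\sum_{e}p(d_{t-1}=e|x_{t-1}=x,d_{t-2}=d)\,F_{R_t|x_{t-1}d_{t-1}}\big(r,(x,e)\big),$$ $$\tilde X_t(q,w,r)=\sum_{x,d}F^{-1}_{R_t|x_{t-1}d_{t-1}}\big((x,d),q\big)\sum_{y}p(x_t=y|x_{t-1}=x,d_{t-1}=d)\,O(w|y)\,F_{R_t|x_td_{t-1}}\big(r,(y,d)\big),$$ $$\tilde O(v,w)=\sum_xO^{-1}(x,v)\,O(w|x).$$ The final tensor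 is $$\tilde X^{\rm fin}_t(q,w)=\sum_{x,d}F^{-1}_{R_t|x_{t-1}d_{t-1}}\big((x,d),q\big)\sum_{y}p(x_t=y|x_{t-1}=x,d_{t-1}=d)\,O(w|y),$$ and the initial tensor is $$\tilde X^{\rm root}(v,w,r)=\sum_{x,d}p(x_1=x,d_1=d)\,O(v|x)\sum_yp(x_2=y|x_1=x,d_1=d)\,O(w|y)\,F_{R_2|x_2d_1}\big(r,(y,d)\big).$$ **Conclusions.** 1. (Product representation.) For every $T\ge3$ and all $u_1,\dots,u_T$, $$p(o_1=u_1,\dots,o_T=u_T)=\big(\tilde X^{\rm root}\times\tilde O|_{u_1}\times\tilde O|_{u_2}\big)\times\prod_{t=3}^{T-1}\tilde D_t\times\big(\tilde X_t\times\tilde O|_{u_t}\big)\times\tilde D_T\times\big(\tilde X^{\rm fin}_T\times\tilde O|_{u_T}\big),$$ where consecutive factors are multiplied along their common observable modes and $\tilde O|_{u}=\tilde O(\cdot,u)$. Equivalently, also for $T=2$, it is the sum over $r$ of the entries of $(\tilde X^{\rm root}\times\tilde O|_{u_1}\times\tilde O|_{u_2})\times\prod_{t=3}^{T}\tilde D_t\times(\tilde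 X_t\times\tilde O|_{u_t})$. Moreover $\tilde X^{\rm root}(v,w,r)=p(o_1=v,o_2=w,O_{R_2}=r)$ and, for $t\ge 3$, $\tilde X^{\rm fin}_t(q,w)=\sum_r\tilde X_t(q,w,r)$. 2. (Homogeneity.) $\tilde D_t$ and $\tilde X_t$ do not depend on $t\ge3$. 3. (Observable forms.) Let $M(\cdot,\cdot)$ denote the joint probability tensors of the indicated observations, inverted with respect to $O_L$ (for the last formula: $o_{t+1}$). For $t\ge3$, * $\tilde D_t=M(O_{L_{t-1}},O_{R_{t-1}})^{-1}\times_{O_{L_{t-1}}}M(O_{L_{t-1}},O_{R_t})$, if $O_{L_{t-1}}$ exists and $\operatorname{rank}F_{L_{t-1}|x_{t-1}d_{t-2}}=n_xn_d$; * $\tilde X_t=M(O_{L_t},O_{R_t})^{-1}\times_{O_{L_t}}M(O_{L_t},O_{R_t},o_t)$, if $O_{L_t}$ exists and $\operatorname{rank}F_{L_t|x_td_{t-1}}=n_xn_d$; and, for $t\ge1$, $\tilde O=M(o_t,o_{t+1})^{-1}\times_{o_{t+1}}M(o_t,o_{t+1})$, if $\operatorname{rank}p(o_{t+1}|x_t)=n_x$.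 4. (Pooled forms.) For every finite set $I$ of times, the same tensors satisfy, for every $t\ge3$, * $\tilde D_t=\big(\sum_{s\in I}M(O_{L_{s-1}},O_{R_{s-1}})\big)^{-1}\times_{O_L}\sum_{s\in I}M(O_{L_{s-1}},O_{R_s})$, if $s\ge3$ and $O_{L_{s-1}}$ exists for all $s\in I$, and the pooled matrix $\sum_{s\in I}p(O_{L_{s-1}},x_{s-1},d_{s-2})$ has rank $n_xn_d$; * $\tilde X_t=\big(\sum_{s\in I}M(O_{L_s},O_{R_s})\big)^{-1}\times_{O_L}\sum_{s\in I}M(O_{L_s},O_{R_s},o_s)$, if $s\ge3$ and $O_{L_s}$ exists for all $s\in I$, and $\sum_{s\in I}p(O_{L_s},x_s,d_{s-1})$ has rank $n_xn_d$; * $\tilde O=\big(\sum_{s\in I}M(o_s,o_{s+1})\big)^{-1}\times_{o}\sum_{s\in I}M(o_s,o_{s+1})$, where $o$ is the mode of $o_{s+1}$, if $s\ge1$ for all $s\in I$ and $\sum_{s\in I}p(o_{s+1},x_s)$ has rank $n_x$. -/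

import Mathlib

open MeasureTheory ProbabilityTheory
open scoped Matrix

/-- The four Penrose equations for real matrices: `B` is the Moore-Penrose inverse of `A`. -/
structure IsPenroseInverse {m n : Type*} [Fintype m] [Fintype n]
    (A : Matrix m n ℝ) (B : Matrix n m ℝ) : Prop where
  mul_mul_left : A * B * A = A
  mul_mul_right : B * A * B = B
  symm_left : (A * B)ᵀ = A * B
  symm_right : (B * A)ᵀ = B * A

theorem IsPenroseInverse.unique {m n : Type*} [Fintype m] [Fintype n]
    {A : Matrix m n ℝ} {B C : Matrix n m ℝ}
    (hB : IsPenroseInverse A B) (hC : IsPenroseInverse A C) : B = C := by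
  have h1 : A * B = A * C := by
    calc A * B = (A * C * A) * B := by rw [hC.mul_mul_left]
      _ = (A * C)ᵀ * (A * B)ᵀ := by rw [hC.symm_left, hB.symm_left]; simp only [Matrix.mul_assoc]
      _ = (A * B * A * C)ᵀ := by rw [← Matrix.transpose_mul]; simp only [Matrix.mul_assoc]
      _ = A * C := by rw [hB.mul_mul_left, hC.symm_left]
  have h2 : B * A = C * A := by
    calc B * A = B * (A * C * A) := by rw [hC.mul_mul_left]
      _ = (B * A)ᵀ * (C * A)ᵀ := by rw [hC.symm_right, hB.symm_right]; simp only [Matrix.mul_assoc]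
      _ = (C * (A * B * A))ᵀ := by rw [← Matrix.transpose_mul]; simp only [Matrix.mul_assoc]
      _ = C * A := by rw [hB.mul_mul_left, hC.symm_right]
  calc B = B * (A * B) := by rw [← Matrix.mul_assoc, hB.mul_mul_right]
    _ = B * A * C := by rw [h1, Matrix.mul_assoc]
    _ = C := by rw [h2, hC.mul_mul_right]

theorem exists_isPenroseInverse {m n : Type*} [Fintype m] [Fintype n]
    (A : Matrix m n ℝ) : ∃ B : Matrix n m ℝ, IsPenroseInverse A B := by
  classical
  have hH : (Aᵀ * A).IsHermitian := by
    simpa [Matrix.conjTranspose_eq_transpose_of_trivial] using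
      Matrix.isHermitian_conjTranspose_mul_self A
  obtain ⟨U, v, hUU, hAU⟩ : ∃ (U : Matrix n n ℝ) (v : n → ℝ),
      Uᵀ * U = 1 ∧ Aᵀ * A = U * Matrix.diagonal v * Uᵀ := by
    refine ⟨hH.eigenvectorUnitary, hH.eigenvalues, ?_, ?_⟩
    · have := Unitary.coe_star_mul_self hH.eigenvectorUnitary
      simpa [Matrix.star_eq_conjTranspose, Matrix.conjTranspose_eq_transpose_of_trivial] using this
    · have := hH.spectral_theorem
      simpa [Unitary.conjStarAlgAut_apply, Matrix.star_eq_conjTranspose,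
        Matrix.conjTranspose_eq_transpose_of_trivial, Function.comp_def] using this
  set P : Matrix n n ℝ := U * Matrix.diagonal (fun i => (v i)⁻¹) * Uᵀ with hP
  have key : ∀ f g : n → ℝ, U * Matrix.diagonal f * Uᵀ * (U * Matrix.diagonal g * Uᵀ)
      = U * Matrix.diagonal (fun i => f i * g i) * Uᵀ := by
    intro f g
    calc U * Matrix.diagonal f * Uᵀ * (U * Matrix.diagonal g * Uᵀ)
        = U * Matrix.diagonal f * (Uᵀ * U) * Matrix.diagonal g * Uᵀ := by
          simp only [Matrix.mul_assoc]
      _ = _ := by rw [hUU, Matrix.mul_one, Matrix.mul_assoc U, Matrix.diagonal_mul_diagonal]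
  have sym : ∀ f : n → ℝ, (U * Matrix.diagonal f * Uᵀ)ᵀ = U * Matrix.diagonal f * Uᵀ := by
    intro f
    simp [Matrix.transpose_mul, Matrix.mul_assoc]
  have hPH : P * (Aᵀ * A) = U * Matrix.diagonal (fun i => (v i)⁻¹ * v i) * Uᵀ := by
    rw [hAU, hP, key]
  have hPHP : P * (Aᵀ * A) * P = P := by
    rw [hPH, hP, key]
    congr 3
    funext i
    by_cases h : v i = 0 <;> simp [h]
  have hHPH : Aᵀ * A * (P * (Aᵀ * A)) = Aᵀ * A := by
    rw [hPH, hAU, key]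
    congr 3
    funext i
    by_cases h : v i = 0 <;> simp [h]
  have hAPH : A * (P * (Aᵀ * A)) = A := by
    have h0 : (A * (P * (Aᵀ * A)) - A)ᴴ * (A * (P * (Aᵀ * A)) - A) = 0 := by
      have h1 : A * (P * (Aᵀ * A)) - A = A * (P * (Aᵀ * A) - 1) := by
        rw [Matrix.mul_sub, Matrix.mul_one]
      rw [h1, Matrix.conjTranspose_eq_transpose_of_trivial, Matrix.transpose_mul,
        Matrix.mul_assoc, ← Matrix.mul_assoc Aᵀ, Matrix.mul_sub, hHPH, Matrix.mul_one, sub_self,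
        Matrix.mul_zero]
    exact sub_eq_zero.mp (Matrix.conjTranspose_mul_self_eq_zero.mp h0)
  refine ⟨P * Aᵀ, ?_, ?_, ?_, ?_⟩
  · simpa only [Matrix.mul_assoc] using hAPH
  · calc P * Aᵀ * A * (P * Aᵀ) = P * (Aᵀ * A) * P * Aᵀ := by simp only [Matrix.mul_assoc]
      _ = P * Aᵀ := by rw [hPHP]
  · rw [Matrix.transpose_mul, Matrix.transpose_mul, Matrix.transpose_transpose, hP, sym,
      Matrix.mul_assoc]
  · rw [Matrix.mul_assoc, hPH, sym]

/-- The Moore-Penrose inverse of a real matrix. For a matrix of full column (row) rank it is a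
left (right) inverse. -/
noncomputable def pinv {m n : Type*} [Fintype m] [Fintype n] (A : Matrix m n ℝ) :
    Matrix n m ℝ :=
  Classical.choose (exists_isPenroseInverse A)

theorem pinv_spec {m n : Type*} [Fintype m] [Fintype n] (A : Matrix m n ℝ) :
    IsPenroseInverse A (pinv A) :=
  Classical.choose_spec (exists_isPenroseInverse A)

/-- Parameters of a hidden semi-Markov model with `nx` latent states, `no` observation symbols and
maximal duration `nd`. The element `d : Fin nd` stands for the duration `d + 1`, so that the
duration `1` is the element of `Fin nd` with value `0`. -/
structure HSMM (nx nd no : ℕ) where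
  /-- `D d x = p(d_t = d | x_t = x, d_{t-1} = 1)`. -/
  D : Matrix (Fin nd) (Fin nx) ℝ
  /-- `X y x = p(x_t = y | x_{t-1} = x, d_{t-1} = 1)`. -/
  X : Matrix (Fin nx) (Fin nx) ℝ
  /-- `O w x = p(o_t = w | x_t = x)`. -/
  O : Matrix (Fin no) (Fin nx) ℝ
  /-- The law of `(x_0, d_0)`. -/
  prior : Fin nx → Fin nd → ℝ
  D_nonneg : ∀ d x, 0 ≤ D d x
  X_nonneg : ∀ y x, 0 ≤ X y x
  O_nonneg : ∀ w x, 0 ≤ O w x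
  prior_nonneg : ∀ x d, 0 ≤ prior x d
  D_sum : ∀ x, ∑ d, D d x = 1
  X_sum : ∀ x, ∑ y, X y x = 1
  O_sum : ∀ x, ∑ w, O w x = 1
  prior_sum : ∑ x, ∑ d, prior x d = 1

namespace HSMM

variable {nx nd no : ℕ}

/-- `dur e x d = p(d_t = e | x_t = x, d_{t-1} = d)`. -/
noncomputable def dur (θ : HSMM nx nd no) (e : Fin nd) (x : Fin nx) (d : Fin nd) : ℝ :=
  if (d : ℕ) = 0 then θ.D e x else if (e : ℕ) + 1 = d then 1 else 0

/-- `trans y x d = p(x_t = y | x_{t-1} = x, d_{t-1} = d)`. -/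
noncomputable def trans (θ : HSMM nx nd no) (y x : Fin nx) (d : Fin nd) : ℝ :=
  if (d : ℕ) = 0 then θ.X y x else if y = x then 1 else 0

/-- Assumptions A1, A2 and A3 on the parameters. -/
structure Regular (θ : HSMM nx nd no) : Prop where
  X_rank : θ.X.rank = nx
  X_pos : ∀ y x, y ≠ x → 0 < θ.X y x
  D_pos : ∀ d x, 0 < θ.D d x
  O_rank : θ.O.rank = nx

end HSMM

/-- A stochastic process `(x_t, d_t)_{t ≥ 0}`, `(o_t)_{t ≥ 1}` distributed as the hidden
semi-Markov model `θ`; the variable `o 0` plays no role. -/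
structure HSMMProcess {nx nd no : ℕ} (θ : HSMM nx nd no) (Ω : Type*) [MeasurableSpace Ω] where
  P : Measure Ω
  isProb : IsProbabilityMeasure P
  x : ℕ → Ω → Fin nx
  d : ℕ → Ω → Fin nd
  o : ℕ → Ω → Fin no
  x_meas : ∀ t, Measurable (x t)
  d_meas : ∀ t, Measurable (d t)
  o_meas : ∀ t, Measurable (o t)
  law : ∀ (N : ℕ) (a : ℕ → Fin nx) (b : ℕ → Fin nd) (c : ℕ → Fin no),
    P.real {ω | (∀ t ∈ Finset.Icc 0 N, x t ω = a t ∧ d t ω = b t) ∧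
        ∀ t ∈ Finset.Icc 1 N, o t ω = c t}
      = θ.prior (a 0) (b 0) * ∏ t ∈ Finset.Icc 1 N,
          θ.trans (a t) (a (t - 1)) (b (t - 1)) * θ.dur (b t) (a t) (b (t - 1)) *
            θ.O (c t) (a t)

namespace HSMMProcess

variable {nx nd no : ℕ} {θ : HSMM nx nd no} {Ω : Type*} [MeasurableSpace Ω]

/-- The event `x_s = z.1, d_t = z.2`. -/
def evState (S : HSMMProcess θ Ω) (s t : ℕ) (z : Fin nx × Fin nd) : Set Ω :=
  {ω | S.x s ω = z.1 ∧ S.d t ω = z.2}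

/-- The event that the right window `(o_{t+1+i})_{i ∈ R}` takes the value `r`. -/
def evR (S : HSMMProcess θ Ω) (R : Finset ℕ) (t : ℕ) (r : R → Fin no) : Set Ω :=
  {ω | ∀ i : R, S.o (t + 1 + (i : ℕ)) ω = r i}

/-- The event that the left window `(o_{t-1-i})_{i ∈ L}` takes the value `l`; it is used only
when all these indices are at least `1`. -/
def evL (S : HSMMProcess θ Ω) (L : Finset ℕ) (t : ℕ) (l : L → Fin no) : Set Ω :=
  {ω | ∀ i : L, S.o (t - 1 - (i : ℕ)) ω = l i}

/-- The event `o_t = w`. -/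
def evO (S : HSMMProcess θ Ω) (t : ℕ) (w : Fin no) : Set Ω := {ω | S.o t ω = w}

/-! Conditional distributions of observations given latent variables. -/

/-- `p(O_{R_t} | x_t, d_{t-1})`. -/
noncomputable def FR (S : HSMMProcess θ Ω) (R : Finset ℕ) (t : ℕ) :
    Matrix (R → Fin no) (Fin nx × Fin nd) ℝ :=
  Matrix.of fun r z => (cond S.P (S.evState t (t - 1) z)).real (S.evR R t r)

/-- `p(O_{R_t} | x_{t-1}, d_{t-1})`. -/
noncomputable def FRprev (S : HSMMProcess θ Ω) (R : Finset ℕ) (t : ℕ) :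
    Matrix (R → Fin no) (Fin nx × Fin nd) ℝ :=
  Matrix.of fun r z => (cond S.P (S.evState (t - 1) (t - 1) z)).real (S.evR R t r)

/-- `p(O_{L_t} | x_t, d_{t-1})`. -/
noncomputable def FL (S : HSMMProcess θ Ω) (L : Finset ℕ) (t : ℕ) :
    Matrix (L → Fin no) (Fin nx × Fin nd) ℝ :=
  Matrix.of fun l z => (cond S.P (S.evState t (t - 1) z)).real (S.evL L t l)

/-- `p(O_{L_t}, x_t, d_{t-1})`, the product of `p(O_{L_t} | x_t, d_{t-1})` and
`p(x_t, d_{t-1})`. -/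
noncomputable def FLjoint (S : HSMMProcess θ Ω) (L : Finset ℕ) (t : ℕ) :
    Matrix (L → Fin no) (Fin nx × Fin nd) ℝ :=
  Matrix.of fun l z => S.P.real (S.evL L t l ∩ S.evState t (t - 1) z)

/-- `p(o_{t+1} | x_t)`. -/
noncomputable def Fnext (S : HSMMProcess θ Ω) (t : ℕ) : Matrix (Fin no) (Fin nx) ℝ :=
  Matrix.of fun w y => (cond S.P {ω | S.x t ω = y}).real (S.evO (t + 1) w)

/-- `p(o_{t+1}, x_t)`. -/
noncomputable def FnextJoint (S : HSMMProcess θ Ω) (t : ℕ) : Matrix (Fin no) (Fin nx) ℝ :=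
  Matrix.of fun w y => S.P.real (S.evO (t + 1) w ∩ {ω | S.x t ω = y})

/-! Observable moments. -/

/-- `p(O_{L_t}, O_{R_t})`. -/
noncomputable def MLR (S : HSMMProcess θ Ω) (L R : Finset ℕ) (t : ℕ) :
    Matrix (L → Fin no) (R → Fin no) ℝ :=
  Matrix.of fun l r => S.P.real (S.evL L t l ∩ S.evR R t r)

/-- `p(O_{L_t}, O_{R_{t+1}})`. -/
noncomputable def MLRnext (S : HSMMProcess θ Ω) (L R : Finset ℕ) (t : ℕ) :
    Matrix (L → Fin no) (R → Fin no) ℝ :=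
  Matrix.of fun l r => S.P.real (S.evL L t l ∩ S.evR R (t + 1) r)

/-- `p(O_{L_t}, O_{R_t}, o_t)`, as a family of matrices indexed by the mode `o_t`. -/
noncomputable def MLRo (S : HSMMProcess θ Ω) (L R : Finset ℕ) (t : ℕ) (w : Fin no) :
    Matrix (L → Fin no) (R → Fin no) ℝ :=
  Matrix.of fun l r => S.P.real (S.evL L t l ∩ S.evR R t r ∩ S.evO t w)

/-- `p(o_t, o_{t+1})`; the rows are indexed by `o_{t+1}` and the columns by `o_t`. -/
noncomputable def Moo (S : HSMMProcess θ Ω) (t : ℕ) : Matrix (Fin no) (Fin no) ℝ :=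
  Matrix.of fun v w => S.P.real (S.evO t w ∩ S.evO (t + 1) v)

/-! Transformed tensors, defined through the latent variables. -/

/-- `D̃_t`, with modes `O_{R_{t-1}}` (rows) and `O_{R_t}` (columns). -/
noncomputable def Dtilde (S : HSMMProcess θ Ω) (R : Finset ℕ) (t : ℕ) :
    Matrix (R → Fin no) (R → Fin no) ℝ :=
  Matrix.of fun q r => ∑ x : Fin nx, ∑ d : Fin nd,
    pinv (S.FR R (t - 1)) (x, d) q * ∑ e : Fin nd, θ.dur e x d * S.FRprev R t r (x, e)

/-- `X̃_t`, with modes `O_{R_t}` (rows), `o_t` (the index `w`) and `O_{R_t}` (columns). -/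
noncomputable def Xtilde (S : HSMMProcess θ Ω) (R : Finset ℕ) (t : ℕ) (w : Fin no) :
    Matrix (R → Fin no) (R → Fin no) ℝ :=
  Matrix.of fun q r => ∑ x : Fin nx, ∑ d : Fin nd,
    pinv (S.FRprev R t) (x, d) q *
      ∑ y : Fin nx, θ.trans y x d * θ.O w y * S.FR R t r (y, d)

/-- `Õ`, with modes `ω_{x_t} = o_t` (rows) and `o_t` (columns). The conditional distribution
`p(o_t | x_t)` is the matrix `O` of the model. -/
noncomputable def Otilde (θ : HSMM nx nd no) : Matrix (Fin no) (Fin no) ℝ :=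
  Matrix.of fun v w => ∑ x : Fin nx, pinv θ.O x v * θ.O w x

/-- The initial tensor, with modes `o_1`, `o_2` and `O_{R_2}`. -/
noncomputable def Xroot (S : HSMMProcess θ Ω) (R : Finset ℕ) (v w : Fin no) (r : R → Fin no) : ℝ :=
  ∑ x : Fin nx, ∑ d : Fin nd, S.P.real (S.evState 1 1 (x, d)) * θ.O v x *
    ∑ y : Fin nx, θ.trans y x d * θ.O w y * S.FR R 2 r (y, d)

/-- The final tensor at time `t`, with modes `O_{R_t}` and `o_t` (the index `w`). -/
noncomputable def Xfinal (S : HSMMProcess θ Ω) (R : Finset ℕ) (t : ℕ) (w : Fin no)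
    (q : R → Fin no) : ℝ :=
  ∑ x : Fin nx, ∑ d : Fin nd, pinv (S.FRprev R t) (x, d) q *
    ∑ y : Fin nx, θ.trans y x d * θ.O w y

/-- The product of the transformed tensors for the observed symbols `u 1, …, u (k + 2)`: the
initial tensor multiplied by `Õ|_{u_1}` and `Õ|_{u_2}`, followed by the factors
`D̃_t × (X̃_t × Õ|_{u_t})` for `t = 3, …, k + 2`. The free mode is `O_{R_{k+2}}`. -/
noncomputable def tensorProd (S : HSMMProcess θ Ω) (R : Finset ℕ) (u : ℕ → Fin no) :
    ℕ → (R → Fin no) → ℝ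
  | 0 => fun r => ∑ v, ∑ w, S.Xroot R v w r * Otilde θ v (u 1) * Otilde θ w (u 2)
  | k + 1 => (S.tensorProd R u k ᵥ* S.Dtilde R (k + 3)) ᵥ*
      ∑ w, Otilde θ w (u (k + 3)) • S.Xtilde R (k + 3) w

end HSMMProcess

/-! ### Moore–Penrose inverses of matrices of full column rank. -/

section Pinv

/-! Everything reduces to one matrix `G = windowLaw`, the law of the right window given `(x_t,
d_{t-1})`, computed from the parameters alone. Full column rank of `FR` forces every conditioning
event to have positive probability, so the Markov property identifies `FR` with `G` at every time `t
≥ 2`; hence `G⁺ G = 1`. Positivity of `D` carries this positivity over to `(x_{t-1}, d_{t-1})`, and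
for `t ≥ 3` `FRprev` becomes `G K`, where `K = stateStep` is invertible because `X` is.

Write `Δ = durStep` and `E_w = emission w`. Since `(G K)⁺ = K⁻¹ G⁺`, the tensors are, up to
transposition, `G K Δ G⁺` for `D̃` and `G E_w G⁺` for `X̃`. These formulas contain no time, which is
homogeneity. They are the forward operators conjugated by `G`: if `f_t` is the joint law of `o_1, …,
o_t` with `(x_t, d_{t-1})`, then `f_{t+1} = E K Δ f_t`, and in the tensor product the inner factors
`G⁺ G` cancel, leaving `G f_T`. The columns of `G` sum to one, so summing out the window gives the
probability of the observations. The factors `Õ` only select the observed symbol, by `O O⁺ O = O`.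

For the observable forms, conditional independence of past and future given `(x_t, d_{t-1})` factors
each moment as `J Bᵀ`, with `J` the joint law of left window and latent pair, and `B` one of `G`, `G
K Δ`, `G E_w`. The reverse order law `(J Gᵀ)⁺ = (G⁺)ᵀ J⁺` and `J⁺ J = 1` eliminate `J`. As `B` does
not depend on time, the same computation applies after summing over a pool of times. -/

theorem mul_left_cancel_of_rank_eq_card {l m n : Type*} [Fintype n] {A : Matrix m n ℝ}
    (hA : A.rank = Fintype.card n)
    {B C : Matrix n l ℝ} (h : A * B = A * C) : B = C := by
  have hinj : Function.Injective A.mulVec := by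
    rw [Matrix.mulVec_injective_iff, linearIndependent_iff_card_eq_finrank_span, ← hA,
      Matrix.rank_eq_finrank_span_cols]
    rfl
  ext i j
  have hj : A *ᵥ (fun i => B i j) = A *ᵥ (fun i => C i j) := by
    funext k
    exact congrFun (congrFun h k) j
  exact congrFun (hinj hj) i

variable {l m n : Type*} [Fintype l] [Fintype m] [Fintype n] [DecidableEq n]

theorem pinv_mul_self_of_rank_eq_card {A : Matrix m n ℝ} (hA : A.rank = Fintype.card n) :
    pinv A * A = 1 := by
  refine mul_left_cancel_of_rank_eq_card hA ?_
  rw [← Matrix.mul_assoc, (pinv_spec A).mul_mul_left, Matrix.mul_one]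

/-- The reverse order law for a product of a matrix of full column rank and a matrix of full
row rank. -/
theorem pinv_mul_transpose {A : Matrix l n ℝ} {B : Matrix m n ℝ} (hA : pinv A * A = 1)
    (hB : pinv B * B = 1) : pinv (A * Bᵀ) = (pinv B)ᵀ * pinv A := by
  have hB' : Bᵀ * (pinv B)ᵀ = 1 := by rw [← Matrix.transpose_mul, hB, Matrix.transpose_one]
  have h1 : A * Bᵀ * ((pinv B)ᵀ * pinv A) = A * pinv A := by
    rw [Matrix.mul_assoc, ← Matrix.mul_assoc Bᵀ, hB', Matrix.one_mul]
  have h2 : (pinv B)ᵀ * pinv A * (A * Bᵀ) = (B * pinv B)ᵀ := by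
    rw [Matrix.mul_assoc, ← Matrix.mul_assoc (pinv A), hA, Matrix.one_mul, Matrix.transpose_mul]
  refine (pinv_spec _).unique ⟨?_, ?_, ?_, ?_⟩
  · rw [h1, ← Matrix.mul_assoc, (pinv_spec A).mul_mul_left]
  · rw [Matrix.mul_assoc, h1, Matrix.mul_assoc, ← Matrix.mul_assoc (pinv A), hA, Matrix.one_mul]
  · rw [h1, (pinv_spec A).symm_left]
  · rw [h2, (pinv_spec B).symm_left, (pinv_spec B).symm_left]

/-- The reverse order law fails for general products. Here `A⁺ A = 1` makes one product `A A⁺` and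
the other the identity, both symmetric. -/
theorem pinv_mul_of_isUnit {A : Matrix m n ℝ} {K : Matrix n n ℝ} (hA : pinv A * A = 1)
    (hK : IsUnit K) : pinv (A * K) = K⁻¹ * pinv A := by
  have hdet := (Matrix.isUnit_iff_isUnit_det K).1 hK
  have h1 : A * K * (K⁻¹ * pinv A) = A * pinv A := by
    rw [Matrix.mul_assoc, ← Matrix.mul_assoc K, Matrix.mul_nonsing_inv _ hdet, Matrix.one_mul]
  have h2 : K⁻¹ * pinv A * (A * K) = 1 := by
    rw [Matrix.mul_assoc, ← Matrix.mul_assoc (pinv A), hA, Matrix.one_mul,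
      Matrix.nonsing_inv_mul _ hdet]
  refine (pinv_spec _).unique ⟨?_, ?_, ?_, ?_⟩
  · rw [h1, ← Matrix.mul_assoc, (pinv_spec A).mul_mul_left]
  · rw [h2, Matrix.one_mul]
  · rw [h1, (pinv_spec A).symm_left]
  · rw [h2, Matrix.transpose_one]

theorem exists_ne_zero_of_rank_eq_card {A : Matrix m n ℝ} (hA : A.rank = Fintype.card n) (j : n) :
    ∃ i, A i j ≠ 0 := by
  by_contra! h
  have := congrFun (congrFun (pinv_mul_self_of_rank_eq_card hA) j) j
  simp [Matrix.mul_apply, h] at this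

/-- Scaling the columns of a matrix of full column rank keeps the rank, provided that the scaling
factor vanishes only at null columns. -/
theorem rank_eq_card_of_scaled {A B : Matrix m n ℝ} {c : n → ℝ} (hA : A.rank = Fintype.card n)
    (hB : ∀ i j, B i j = A i j * c j) (hc : ∀ j, c j = 0 → ∀ i, A i j = 0) :
    B.rank = Fintype.card n := by
  have hBA : B = A * Matrix.diagonal c := by
    ext i j
    rw [Matrix.mul_diagonal, hB]
  rw [hBA, Matrix.rank_mul_eq_left_of_isUnit_det, hA]
  rw [Matrix.det_diagonal, isUnit_iff_ne_zero, Finset.prod_ne_zero_iff]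
  intro j _ h0
  obtain ⟨i, hi⟩ := exists_ne_zero_of_rank_eq_card hA j
  exact hi (hc j h0 i)

end Pinv

/-! ### Window law and transition matrices built from the parameters. -/

namespace HSMM

variable {nx nd no : ℕ}

/-- The probability that the next `n` observations lie in `s 0, …, s (n - 1)`, given the current
state and duration. -/
noncomputable def futureProb (θ : HSMM nx nd no) :
    ℕ → (ℕ → Finset (Fin no)) → Fin nx → Fin nd → ℝ
  | 0, _, _, _ => 1
  | n + 1, s, x, d => ∑ y, ∑ e, ∑ w ∈ s 0, θ.trans y x d * θ.dur e y d * θ.O w y *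
      θ.futureProb n (fun j => s (j + 1)) y e

/-- The values admitted at each offset by the window value `r`. -/
def windowPattern (R : Finset ℕ) (r : R → Fin no) (j : ℕ) : Finset (Fin no) :=
  if h : j ∈ R then {r ⟨j, h⟩} else Finset.univ

/-- The law of the right window given the current state and the previous duration. -/
noncomputable def windowLaw (θ : HSMM nx nd no) (R : Finset ℕ) :
    Matrix (R → Fin no) (Fin nx × Fin nd) ℝ :=
  Matrix.of fun r z => ∑ e, θ.dur e z.1 z.2 *
    θ.futureProb (R.sup id + 1) (windowPattern R r) z.1 e

/-- The state transition at a fixed duration, as a matrix. -/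
noncomputable def stateStep (θ : HSMM nx nd no) : Matrix (Fin nx × Fin nd) (Fin nx × Fin nd) ℝ :=
  Matrix.of fun z' z => if z'.2 = z.2 then θ.trans z'.1 z.1 z.2 else 0

/-- The duration transition at a fixed state, as a matrix. -/
noncomputable def durStep (θ : HSMM nx nd no) : Matrix (Fin nx × Fin nd) (Fin nx × Fin nd) ℝ :=
  Matrix.of fun z' z => if z'.1 = z.1 then θ.dur z'.2 z.1 z.2 else 0

/-- The emission probabilities of the symbol `w`, as a diagonal matrix. -/
noncomputable def emission (θ : HSMM nx nd no) (w : Fin no) :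
    Matrix (Fin nx × Fin nd) (Fin nx × Fin nd) ℝ :=
  Matrix.diagonal fun z => θ.O w z.1

theorem sum_dur (θ : HSMM nx nd no) (x : Fin nx) (d : Fin nd) : ∑ e, θ.dur e x d = 1 := by
  by_cases h : (d : ℕ) = 0
  · simp [dur, h, θ.D_sum]
  · have hd := d.2
    simp only [dur, h, if_false]
    rw [Finset.sum_eq_single ⟨(d : ℕ) - 1, by omega⟩]
    · rw [if_pos (by simp only; omega)]
    · intro e _ he
      rw [if_neg]
      intro h'
      exact he (Fin.ext (by simp only; omega))
    · simp

/-- The matrix is block diagonal in the duration: the block at index `0` is `X`, all others are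
identities. Inverting blockwise gives a left inverse, which suffices for a square matrix. -/
theorem isUnit_stateStep (θ : HSMM nx nd no) (hX : θ.X.rank = nx) : IsUnit θ.stateStep := by
  have hinv : pinv θ.X * θ.X = 1 := pinv_mul_self_of_rank_eq_card (by rw [hX, Fintype.card_fin])
  refine IsUnit.of_mul_eq_one_right (Matrix.of fun z' z : Fin nx × Fin nd =>
    if z'.2 = z.2 then (if (z.2 : ℕ) = 0 then pinv θ.X z'.1 z.1 else
      if z'.1 = z.1 then 1 else 0) else 0) ?_
  ext ⟨x', d'⟩ ⟨x, d⟩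
  have h := congrFun (congrFun hinv x') x
  rw [Matrix.mul_apply] at h
  rw [Matrix.mul_apply, Fintype.sum_prod_type_right, Finset.sum_eq_single d']
  · by_cases hd : d' = d
    · subst hd
      by_cases h0 : (d' : ℕ) = 0
      · simp [stateStep, trans, h0, h, Matrix.one_apply, Prod.ext_iff]
      · simp [stateStep, trans, h0, Matrix.one_apply, Prod.ext_iff]
    · simp [stateStep, hd, Prod.ext_iff]
  · intro e _ he
    refine Finset.sum_eq_zero fun y _ => ?_
    simp [he.symm]
  · simp

theorem windowLaw_mul_stateStep (θ : HSMM nx nd no) (R : Finset ℕ) (r : R → Fin no) (x : Fin nx)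
    (d : Fin nd) :
    (θ.windowLaw R * θ.stateStep) r (x, d) = ∑ y, θ.trans y x d * θ.windowLaw R r (y, d) := by
  rw [Matrix.mul_apply, Fintype.sum_prod_type]
  refine Finset.sum_congr rfl fun y _ => ?_
  simp [stateStep, mul_comm]

end HSMM

/-! ### Markov properties derived from the finite-dimensional laws. -/

namespace HSMMProcess

variable {nx nd no : ℕ} {θ : HSMM nx nd no} {Ω : Type*} [MeasurableSpace Ω]

instance (S : HSMMProcess θ Ω) : IsProbabilityMeasure S.P := S.isProb

theorem sum_real_inter_preimage {ι : Type*} [Fintype ι] [MeasurableSpace ι]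
    [MeasurableSingletonClass ι] (P : Measure Ω) [IsFiniteMeasure P] {f : Ω → ι}
    (hf : Measurable f) (C : Set Ω) : ∑ i, P.real (C ∩ {ω | f ω = i}) = P.real C := by
  have h := sum_measureReal_preimage_singleton (μ := P.restrict C) (Finset.univ : Finset ι) (f := f)
    (fun i _ => hf (measurableSet_singleton i))
  rw [Finset.coe_univ, Set.preimage_univ, measureReal_restrict_apply_univ] at h
  rw [← h]
  refine Finset.sum_congr rfl fun i _ => ?_
  rw [measureReal_restrict_apply (hf (measurableSet_singleton i)), Set.inter_comm]
  rfl

/-- The hidden and observed history up to time `t`. -/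
def hist (S : HSMMProcess θ Ω) (t : ℕ) (ω : Ω) :
    (Fin (t + 1) → Fin nx × Fin nd) × (Fin t → Fin no) :=
  (fun i => (S.x i ω, S.d i ω), fun i => S.o (i + 1) ω)

theorem measurable_hist (S : HSMMProcess θ Ω) (t : ℕ) : Measurable (S.hist t) :=
  (measurable_pi_lambda _ fun i : Fin (t + 1) => (S.x_meas i).prodMk (S.d_meas i)).prodMk
    (measurable_pi_lambda _ fun i : Fin t => S.o_meas (i + 1))

theorem hist_eq_iff (S : HSMMProcess θ Ω) (t : ℕ) (ω ω' : Ω) :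
    S.hist t ω = S.hist t ω' ↔ (∀ s ≤ t, S.x s ω = S.x s ω' ∧ S.d s ω = S.d s ω') ∧
      ∀ s, 1 ≤ s → s ≤ t → S.o s ω = S.o s ω' := by
  simp only [hist, Prod.ext_iff, funext_iff]
  refine and_congr ⟨fun h s hs => h ⟨s, by omega⟩, fun h i => h i (by omega)⟩
    ⟨fun h s h1 hs => ?_, fun h i => h (i + 1) (by omega) (by omega)⟩
  have := h ⟨s - 1, by omega⟩
  simpa only [Nat.sub_add_cancel h1] using this

/-- The events determined by the history up to time `t`. -/
def Past (S : HSMMProcess θ Ω) (t : ℕ) (A : Set Ω) : Prop :=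
  ∀ ω ω', S.hist t ω = S.hist t ω' → ω ∈ A → ω' ∈ A

/-- The event that the first `t` observations are `u 1, …, u t`. -/
def evObs (S : HSMMProcess θ Ω) (u : ℕ → Fin no) (t : ℕ) : Set Ω :=
  {ω | ∀ i ∈ Finset.Icc 1 t, S.o i ω = u i}

variable {S : HSMMProcess θ Ω} {s t : ℕ} {A B : Set Ω}

theorem Past.inter (hA : S.Past t A) (hB : S.Past t B) : S.Past t (A ∩ B) :=
  fun ω ω' h hω => ⟨hA ω ω' h hω.1, hB ω ω' h hω.2⟩

theorem Past.mono (hA : S.Past s A) (hst : s ≤ t) : S.Past t A := by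
  intro ω ω' h
  rw [hist_eq_iff] at h
  exact hA ω ω' ((S.hist_eq_iff s ω ω').2 ⟨fun i hi => h.1 i (hi.trans hst),
    fun i h1 hi => h.2 i h1 (hi.trans hst)⟩)

theorem past_univ : S.Past t Set.univ := fun _ _ _ _ => trivial

theorem past_x (y : Fin nx) : S.Past t {ω | S.x t ω = y} := by
  intro ω ω' h hω
  rw [hist_eq_iff] at h
  exact (h.1 t le_rfl).1.symm.trans hω

theorem past_d (e : Fin nd) : S.Past t {ω | S.d t ω = e} := by
  intro ω ω' h hω
  rw [hist_eq_iff] at h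
  exact (h.1 t le_rfl).2.symm.trans hω

theorem past_o (ht : 1 ≤ t) (w : Fin no) : S.Past t (S.evO t w) := by
  intro ω ω' h hω
  rw [hist_eq_iff] at h
  exact (h.2 t ht le_rfl).symm.trans hω

theorem past_evL {L : Finset ℕ} (hL : ∀ i ∈ L, i + 2 ≤ t + 1) (l : L → Fin no) :
    S.Past t (S.evL L (t + 1) l) := by
  intro ω ω' h hω i
  rw [hist_eq_iff] at h
  have hi := hL i i.2
  exact (h.2 (t + 1 - 1 - i) (by omega) (by omega)).symm.trans (hω i)

theorem past_evObs (u : ℕ → Fin no) : S.Past t (S.evObs u t) := by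
  intro ω ω' h hω i hi
  rw [hist_eq_iff] at h
  rw [Finset.mem_Icc] at hi
  exact (h.2 i hi.1 hi.2).symm.trans (hω i (Finset.mem_Icc.2 hi))

/-- The one-step Markov property. -/
theorem real_step (hA : S.Past t A) (x y : Fin nx) (d e : Fin nd) (w : Fin no) :
    S.P.real (A ∩ {ω | S.x t ω = x} ∩ {ω | S.d t ω = d} ∩ {ω | S.x (t + 1) ω = y} ∩
        {ω | S.d (t + 1) ω = e} ∩ S.evO (t + 1) w) =
      S.P.real (A ∩ {ω | S.x t ω = x} ∩ {ω | S.d t ω = d}) *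
        (θ.trans y x d * θ.dur e y d * θ.O w y) := by
  have hC : S.Past t (A ∩ {ω | S.x t ω = x} ∩ {ω | S.d t ω = d}) :=
    (hA.inter (past_x x)).inter (past_d d)
  have hx : ∀ ω ∈ A ∩ {ω | S.x t ω = x} ∩ {ω | S.d t ω = d}, S.x t ω = x := fun ω h => h.1.2
  have hd : ∀ ω ∈ A ∩ {ω | S.x t ω = x} ∩ {ω | S.d t ω = d}, S.d t ω = d := fun ω h => h.2
  generalize A ∩ {ω | S.x t ω = x} ∩ {ω | S.d t ω = d} = C at hC hx hd ⊢
  rw [← sum_real_inter_preimage S.P (S.measurable_hist t) C,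
    ← sum_real_inter_preimage S.P (S.measurable_hist t), Finset.sum_mul]
  -- The event is split along histories `p`. Being determined by the history, it contains the whole
  -- fibre over `p` or misses it, so `law` applies to each fibre it meets through a representative
  -- `ω₀`.
  refine Finset.sum_congr rfl fun p _ => ?_
  by_cases hne : ∃ ω, ω ∈ C ∧ S.hist t ω = p
  · obtain ⟨ω₀, h₀, rfl⟩ := hne
    have h1 := S.law t (fun i => S.x i ω₀) (fun i => S.d i ω₀) (fun i => S.o i ω₀)
    -- The trajectory of `ω₀` extended by `(y, e, w)`: its probability exceeds that in `h1` by
    -- exactly one transition factor.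
    have h2 := S.law (t + 1) (fun i => if i = t + 1 then y else S.x i ω₀)
      (fun i => if i = t + 1 then e else S.d i ω₀) (fun i => if i = t + 1 then w else S.o i ω₀)
    rw [Finset.prod_Icc_succ_top (by omega), ← mul_assoc,
      Finset.prod_congr (g := fun i => θ.trans (S.x i ω₀) (S.x (i - 1) ω₀) (S.d (i - 1) ω₀) *
        θ.dur (S.d i ω₀) (S.x i ω₀) (S.d (i - 1) ω₀) * θ.O (S.o i ω₀) (S.x i ω₀)) rfl ?_] at h2
    · simp only [Nat.add_sub_cancel, if_true, (Nat.succ_ne_self t).symm,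
        (Nat.succ_ne_zero t).symm, if_false] at h2
      rw [← h1, hx ω₀ h₀, hd ω₀ h₀] at h2
      convert h2 using 2
      · ext ω
        simp only [Set.mem_inter_iff, Set.mem_ofPred_eq, hist_eq_iff, Finset.mem_Icc, evO]
        constructor
        · rintro ⟨⟨⟨⟨_, hy⟩, he⟩, hw⟩, h3, h4⟩
          refine ⟨fun i hi => ?_, fun i hi => ?_⟩
          · by_cases h : i = t + 1
            · subst h; simp [hy, he]
            · simpa [h] using h3 i (by omega)
          · by_cases h : i = t + 1
            · subst h; simp [hw]
            · simpa [h] using h4 i (by omega) (by omega)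
        · rintro ⟨h3, h4⟩
          have h3' : ∀ i ≤ t, S.x i ω = S.x i ω₀ ∧ S.d i ω = S.d i ω₀ := fun i hi => by
            simpa [show i ≠ t + 1 by omega] using h3 i (by omega)
          have h4' : ∀ i, 1 ≤ i → i ≤ t → S.o i ω = S.o i ω₀ := fun i h1 hi => by
            simpa [show i ≠ t + 1 by omega] using h4 i (by omega)
          have h5 := h3 (t + 1) (by omega)
          have h6 := h4 (t + 1) (by omega)
          simp only [if_true] at h5 h6
          exact ⟨⟨⟨⟨hC ω₀ ω ((S.hist_eq_iff t _ _).2 ⟨fun i hi => ⟨(h3' i hi).1.symm,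
            (h3' i hi).2.symm⟩, fun i h1 hi => (h4' i h1 hi).symm⟩) h₀, h5.1⟩, h5.2⟩, h6⟩, h3', h4'⟩
      · congr 1
        ext ω
        simp only [Set.mem_inter_iff, Set.mem_ofPred_eq, hist_eq_iff, Finset.mem_Icc]
        refine ⟨fun h => ⟨fun i hi => h.2.1 i hi.2, fun i hi => h.2.2 i hi.1 hi.2⟩, fun h => ?_⟩
        have h' : S.hist t ω₀ = S.hist t ω := (S.hist_eq_iff t _ _).2
          ⟨fun i hi => ⟨(h.1 i ⟨by omega, hi⟩).1.symm, (h.1 i ⟨by omega, hi⟩).2.symm⟩,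
            fun i h1 hi => (h.2 i ⟨h1, hi⟩).symm⟩
        exact ⟨hC ω₀ ω h' h₀, (S.hist_eq_iff t _ _).1 h'.symm⟩
    · intro i hi
      rw [Finset.mem_Icc] at hi
      simp only [show i ≠ t + 1 by omega, show i - 1 ≠ t + 1 by omega, if_false]
  · have h0 : C ∩ {ω | S.hist t ω = p} = ∅ :=
      Set.eq_empty_of_forall_notMem fun ω hω => hne ⟨ω, hω⟩
    have h1 : C ∩ {ω | S.x (t + 1) ω = y} ∩ {ω | S.d (t + 1) ω = e} ∩ S.evO (t + 1) w ∩
        {ω | S.hist t ω = p} = ∅ :=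
      Set.eq_empty_of_forall_notMem fun ω hω => hne ⟨ω, hω.1.1.1.1, hω.2⟩
    rw [h0, h1]
    simp

/-- The observation at time `t + 1` and the duration are drawn independently given the state. -/
theorem real_emit_dur (hA : S.Past t A) (y : Fin nx) (d e : Fin nd) (w : Fin no) :
    S.P.real (A ∩ {ω | S.d t ω = d} ∩ {ω | S.x (t + 1) ω = y} ∩
        {ω | S.d (t + 1) ω = e} ∩ S.evO (t + 1) w) =
      S.P.real (A ∩ {ω | S.d t ω = d} ∩ {ω | S.x (t + 1) ω = y}) * (θ.dur e y d * θ.O w y) := by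
  have key : ∀ e w, S.P.real (A ∩ {ω | S.d t ω = d} ∩ {ω | S.x (t + 1) ω = y} ∩
        {ω | S.d (t + 1) ω = e} ∩ S.evO (t + 1) w) =
      (∑ x, S.P.real (A ∩ {ω | S.x t ω = x} ∩ {ω | S.d t ω = d}) * θ.trans y x d) *
        (θ.dur e y d * θ.O w y) := by
    intro e w
    rw [← sum_real_inter_preimage S.P (S.x_meas t), Finset.sum_mul]
    refine Finset.sum_congr rfl fun x _ => ?_
    rw [mul_assoc, ← mul_assoc (θ.trans y x d), ← real_step hA]
    congr 1
    ext ω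
    simp only [Set.mem_inter_iff]
    tauto
  rw [key]
  -- The bracket in `key` involves neither `e` nor `w`; summing `key` over both identifies it as the
  -- probability without them.
  congr 1
  rw [← sum_real_inter_preimage S.P (S.d_meas (t + 1))]
  simp_rw [← sum_real_inter_preimage S.P (S.o_meas (t + 1)) (_ ∩ {ω | S.d (t + 1) ω = _})]
  change _ = ∑ i, ∑ j, S.P.real (_ ∩ S.evO (t + 1) j)
  simp_rw [key, ← Finset.mul_sum, θ.O_sum, mul_one, θ.sum_dur, mul_one]

theorem real_trans (hA : S.Past t A) (x y : Fin nx) (d : Fin nd) :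
    S.P.real (A ∩ {ω | S.x t ω = x} ∩ {ω | S.d t ω = d} ∩ {ω | S.x (t + 1) ω = y}) =
      S.P.real (A ∩ {ω | S.x t ω = x} ∩ {ω | S.d t ω = d}) * θ.trans y x d := by
  rw [← sum_real_inter_preimage S.P (S.d_meas (t + 1))]
  simp_rw [← sum_real_inter_preimage S.P (S.o_meas (t + 1)) (_ ∩ {ω | S.d (t + 1) ω = _})]
  change ∑ i, ∑ j, S.P.real (_ ∩ S.evO (t + 1) j) = _
  simp_rw [real_step hA, ← Finset.mul_sum, θ.O_sum, mul_one, ← Finset.mul_sum, θ.sum_dur, mul_one]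

theorem real_emit (hA : S.Past t A) (y : Fin nx) (d : Fin nd) (w : Fin no) :
    S.P.real (A ∩ {ω | S.d t ω = d} ∩ {ω | S.x (t + 1) ω = y} ∩ S.evO (t + 1) w) =
      S.P.real (A ∩ {ω | S.d t ω = d} ∩ {ω | S.x (t + 1) ω = y}) * θ.O w y := by
  rw [← sum_real_inter_preimage S.P (S.d_meas (t + 1))]
  simp_rw [Set.inter_right_comm _ (S.evO (t + 1) w), real_emit_dur hA, ← Finset.mul_sum,
    ← Finset.sum_mul, θ.sum_dur, one_mul]

theorem real_dur (hA : S.Past t A) (y : Fin nx) (d e : Fin nd) :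
    S.P.real (A ∩ {ω | S.d t ω = d} ∩ {ω | S.x (t + 1) ω = y} ∩ {ω | S.d (t + 1) ω = e}) =
      S.P.real (A ∩ {ω | S.d t ω = d} ∩ {ω | S.x (t + 1) ω = y}) * θ.dur e y d := by
  rw [← sum_real_inter_preimage S.P (S.o_meas (t + 1))]
  change ∑ j, S.P.real (_ ∩ S.evO (t + 1) j) = _
  simp_rw [real_emit_dur hA, ← Finset.mul_sum, θ.O_sum, mul_one]

/-- The Markov property for finitely many future observations. -/
theorem real_future (hA : S.Past t A) (n : ℕ) (s : ℕ → Finset (Fin no)) (x : Fin nx) (d : Fin nd) :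
    S.P.real (A ∩ {ω | S.x t ω = x} ∩ {ω | S.d t ω = d} ∩
        {ω | ∀ j < n, S.o (t + 1 + j) ω ∈ s j}) =
      S.P.real (A ∩ {ω | S.x t ω = x} ∩ {ω | S.d t ω = d}) * θ.futureProb n s x d := by
  induction n generalizing t s A x d with
  | zero => simp [HSMM.futureProb]
  | succ n ih =>
    rw [HSMM.futureProb, ← sum_real_inter_preimage S.P (S.x_meas (t + 1)), Finset.mul_sum]
    refine Finset.sum_congr rfl fun y _ => ?_
    rw [← sum_real_inter_preimage S.P (S.d_meas (t + 1)), Finset.mul_sum]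
    refine Finset.sum_congr rfl fun e _ => ?_
    rw [← sum_real_inter_preimage S.P (S.o_meas (t + 1)), Finset.mul_sum,
      ← Finset.sum_subset (Finset.subset_univ (s 0))]
    · refine Finset.sum_congr rfl fun w hw => ?_
      -- The state at time `t` and the observation at `t + 1` are absorbed into the past event, so
      -- the induction hypothesis applies from time `t + 1`.
      have hA' : S.Past (t + 1) (A ∩ {ω | S.x t ω = x} ∩ {ω | S.d t ω = d} ∩ S.evO (t + 1) w) :=
        (((hA.inter (past_x x)).inter (past_d d)).mono (Nat.le_succ t)).inter
          (past_o (by omega) w)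
      have h1 := ih hA' (fun j => s (j + 1)) y e
      rw [← mul_assoc, ← real_step hA]
      convert h1 using 2
      · ext ω
        simp only [Set.mem_inter_iff, Set.mem_ofPred_eq, evO]
        constructor
        · rintro ⟨⟨⟨⟨h1, h2⟩, h3⟩, h4⟩, h5⟩
          refine ⟨⟨⟨⟨h1, h5⟩, h3⟩, h4⟩, fun j hj => ?_⟩
          have := h2 (j + 1) (by omega)
          rwa [show t + 1 + (j + 1) = t + 1 + 1 + j by omega] at this
        · rintro ⟨⟨⟨⟨h1, h5⟩, h3⟩, h4⟩, h2⟩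
          refine ⟨⟨⟨⟨h1, fun j hj => ?_⟩, h3⟩, h4⟩, h5⟩
          rcases j with _ | j
          · rw [Nat.add_zero, h5]; exact hw
          · have := h2 j (by omega)
            rwa [show t + 1 + 1 + j = t + 1 + (j + 1) by omega] at this
      · congr 1
        ext ω
        simp only [Set.mem_inter_iff]
        tauto
    · intro w _ hw
      rw [← measureReal_empty (μ := S.P)]
      congr 1
      refine Set.eq_empty_of_forall_notMem fun ω hω => hw ?_
      have h1 := hω.1.1.1.2 0 (Nat.succ_pos n)
      have h2 : S.o (t + 1) ω = w := hω.2
      rwa [Nat.add_zero, h2] at h1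

/-- A window with gaps becomes a constraint on consecutive observations, trivial at the missing
offsets; the length `R.sup id + 1` covers the largest offset. This is the form `real_future`
handles. -/
theorem evR_eq (S : HSMMProcess θ Ω) (R : Finset ℕ) (t : ℕ) (r : R → Fin no) :
    S.evR R t r =
      {ω | ∀ j < R.sup id + 1, S.o (t + 1 + j) ω ∈ HSMM.windowPattern R r j} := by
  ext ω
  simp only [evR, Set.mem_ofPred_eq, HSMM.windowPattern]
  constructor
  · intro h j _
    by_cases hj : j ∈ R
    · simpa [hj] using h ⟨j, hj⟩
    · simp [hj]
  · intro h i
    have := h i (Nat.lt_succ_of_le (Finset.le_sup (f := id) i.2))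
    simpa [i.2] using this

/-- The Markov property for the right window, conditioning on the current state and the previous
duration. -/
theorem real_window (hA : S.Past t A) (R : Finset ℕ) (r : R → Fin no) (y : Fin nx) (d : Fin nd) :
    S.P.real (A ∩ {ω | S.d t ω = d} ∩ {ω | S.x (t + 1) ω = y} ∩ S.evR R (t + 1) r) =
      S.P.real (A ∩ {ω | S.d t ω = d} ∩ {ω | S.x (t + 1) ω = y}) * θ.windowLaw R r (y, d) := by
  rw [← sum_real_inter_preimage S.P (S.d_meas (t + 1)), HSMM.windowLaw, Matrix.of_apply,
    Finset.mul_sum]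
  refine Finset.sum_congr rfl fun e _ => ?_
  have h := real_future ((hA.inter (past_d d)).mono (Nat.le_succ t)) (R.sup id + 1)
    (HSMM.windowPattern R r) y e
  rw [← evR_eq, real_dur hA] at h
  rw [← mul_assoc, ← h, Set.inter_right_comm]

/-- The joint Markov property for the current observation and the right window. -/
theorem real_emit_window (hA : S.Past t A) (R : Finset ℕ) (r : R → Fin no) (y : Fin nx)
    (d : Fin nd) (w : Fin no) :
    S.P.real (A ∩ {ω | S.d t ω = d} ∩ {ω | S.x (t + 1) ω = y} ∩ S.evO (t + 1) w ∩
        S.evR R (t + 1) r) =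
      S.P.real (A ∩ {ω | S.d t ω = d} ∩ {ω | S.x (t + 1) ω = y}) * θ.O w y *
        θ.windowLaw R r (y, d) := by
  rw [← sum_real_inter_preimage S.P (S.d_meas (t + 1)), HSMM.windowLaw, Matrix.of_apply,
    Finset.mul_sum]
  refine Finset.sum_congr rfl fun e _ => ?_
  have h := real_future (((hA.inter (past_d d)).mono (Nat.le_succ t)).inter
    (past_o (by omega) w)) (R.sup id + 1) (HSMM.windowPattern R r) y e
  rw [← evR_eq, Set.inter_right_comm _ (S.evO (t + 1) w), Set.inter_right_comm _ (S.evO (t + 1) w),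
    real_emit_dur hA] at h
  rw [mul_assoc, ← mul_assoc (θ.O w y), mul_comm (θ.O w y), ← mul_assoc, ← h]
  congr 1
  ext ω
  simp only [Set.mem_inter_iff]
  tauto

/-- The Markov property for the right window, conditioning on the previous state and duration. -/
theorem real_window_prev (hA : S.Past t A) (R : Finset ℕ) (r : R → Fin no) (x : Fin nx)
    (d : Fin nd) :
    S.P.real (A ∩ {ω | S.x t ω = x} ∩ {ω | S.d t ω = d} ∩ S.evR R (t + 1) r) =
      S.P.real (A ∩ {ω | S.x t ω = x} ∩ {ω | S.d t ω = d}) *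
        (θ.windowLaw R * θ.stateStep) r (x, d) := by
  rw [HSMM.windowLaw_mul_stateStep, ← sum_real_inter_preimage S.P (S.x_meas (t + 1)),
    Finset.mul_sum]
  refine Finset.sum_congr rfl fun y _ => ?_
  rw [← mul_assoc, ← real_trans hA, Set.inter_right_comm _ (S.evR R (t + 1) r),
    real_window (hA.inter (past_x x))]

end HSMMProcess

/-! ### Conditional matrices identified with the window law, and moments. -/

namespace HSMMProcess

variable {nx nd no : ℕ} {θ : HSMM nx nd no} {Ω : Type*} [MeasurableSpace Ω]
  {S : HSMMProcess θ Ω} {t : ℕ} {A : Set Ω}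

theorem real_cond_eq (P : Measure Ω) {C : Set Ω} (hC : MeasurableSet C) (B : Set Ω) :
    (cond P C).real B = (P.real C)⁻¹ * P.real (C ∩ B) := by
  rw [measureReal_def, cond_apply hC, ENNReal.toReal_mul, ENNReal.toReal_inv]
  rfl

/-- For a null event `C` both sides vanish, so the convention on null columns is harmless. -/
theorem real_cond_mul (P : Measure Ω) [IsFiniteMeasure P] {C : Set Ω} (hC : MeasurableSet C)
    (B : Set Ω) : (cond P C).real B * P.real C = P.real (C ∩ B) := by
  rw [real_cond_eq P hC]
  by_cases h : P.real C = 0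
  · rw [h, mul_zero]
    exact (le_antisymm (h ▸ measureReal_mono Set.inter_subset_left) measureReal_nonneg).symm
  · rw [mul_right_comm, inv_mul_cancel₀ h, one_mul]

/-- The current observation is drawn from the emission law, given the state and the duration. -/
theorem real_emit_state (hA : S.Past t A) (y : Fin nx) (e : Fin nd) (w : Fin no) :
    S.P.real (A ∩ {ω | S.x (t + 1) ω = y} ∩ {ω | S.d (t + 1) ω = e} ∩ S.evO (t + 1) w) =
      S.P.real (A ∩ {ω | S.x (t + 1) ω = y} ∩ {ω | S.d (t + 1) ω = e}) * θ.O w y := by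
  rw [← sum_real_inter_preimage S.P (S.d_meas t),
    ← sum_real_inter_preimage S.P (S.d_meas t) (A ∩ _ ∩ _), Finset.sum_mul]
  refine Finset.sum_congr rfl fun d _ => ?_
  have h := real_emit_dur hA y d e w
  rw [← mul_assoc, ← real_dur hA] at h
  convert h using 2
  · ext ω
    simp only [Set.mem_inter_iff]
    tauto
  · congr 1
    ext ω
    simp only [Set.mem_inter_iff]
    tauto

theorem evState_eq (S : HSMMProcess θ Ω) (s t : ℕ) (z : Fin nx × Fin nd) :
    S.evState s t z = {ω | S.d t ω = z.2} ∩ {ω | S.x s ω = z.1} :=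
  Set.inter_comm _ _

theorem measurableSet_evState (S : HSMMProcess θ Ω) (s t : ℕ) (z : Fin nx × Fin nd) :
    MeasurableSet (S.evState s t z) :=
  (S.x_meas s (measurableSet_singleton z.1)).inter (S.d_meas t (measurableSet_singleton z.2))

theorem sum_real_inter_evState (S : HSMMProcess θ Ω) (s t : ℕ) (C : Set Ω) :
    ∑ z, S.P.real (C ∩ S.evState s t z) = S.P.real C := by
  rw [← sum_real_inter_preimage S.P ((S.x_meas s).prodMk (S.d_meas t)) C]
  simp only [Prod.ext_iff]
  rfl

theorem FR_apply_mul (S : HSMMProcess θ Ω) (R : Finset ℕ) (t : ℕ) (r : R → Fin no)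
    (z : Fin nx × Fin nd) : S.FR R t r z * S.P.real (S.evState t (t - 1) z) =
      S.P.real (S.evState t (t - 1) z ∩ S.evR R t r) := by
  rw [FR, Matrix.of_apply, real_cond_mul _ (measurableSet_evState S t (t - 1) z)]

theorem FR_eq_zero {R : Finset ℕ} {r : R → Fin no} {z : Fin nx × Fin nd}
    (h : S.P.real (S.evState t (t - 1) z) = 0) : S.FR R t r z = 0 := by
  rw [FR, Matrix.of_apply, real_cond_eq _ (measurableSet_evState S t (t - 1) z), h, inv_zero,
    zero_mul]

/-- A null conditioning event would produce a zero column, which full column rank excludes. -/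
theorem real_evState_ne_zero {R : Finset ℕ} (h : (S.FR R t).rank = nx * nd)
    (z : Fin nx × Fin nd) : S.P.real (S.evState t (t - 1) z) ≠ 0 := by
  intro h0
  obtain ⟨r, hr⟩ := exists_ne_zero_of_rank_eq_card (A := S.FR R t) (by simpa using h) z
  exact hr (FR_eq_zero h0)

/-- The Markov property gives the identity multiplied by the probability of the state event; the
rank condition makes that probability nonzero. This is the source of homogeneity. -/
theorem FR_eq_windowLaw {R : Finset ℕ} (h : (S.FR R (t + 1)).rank = nx * nd) :
    S.FR R (t + 1) = θ.windowLaw R := by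
  ext r z
  have h0 := real_evState_ne_zero h z
  have h1 := S.FR_apply_mul R (t + 1) r z
  have h2 := real_window (S := S) (past_univ (t := t)) R r z.1 z.2
  rw [Set.univ_inter, ← evState_eq S (t + 1) t z] at h2
  rw [Nat.add_sub_cancel] at h0 h1
  rw [h2, mul_comm] at h1
  exact mul_left_cancel₀ h0 h1

theorem sum_windowLaw {R : Finset ℕ} (h : (S.FR R (t + 1)).rank = nx * nd)
    (z : Fin nx × Fin nd) : ∑ r, θ.windowLaw R r z = 1 := by
  have h0 := real_evState_ne_zero h z
  rw [Nat.add_sub_cancel] at h0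
  have hf : Measurable fun ω (i : R) => S.o (t + 1 + 1 + i) ω :=
    measurable_pi_lambda _ fun i => S.o_meas (t + 1 + 1 + i)
  refine mul_left_cancel₀ h0 ?_
  rw [mul_one, Finset.mul_sum]
  refine Eq.trans ?_ (sum_real_inter_preimage S.P hf (S.evState (t + 1) t z))
  refine Finset.sum_congr rfl fun r _ => ?_
  have h2 := real_window (S := S) (past_univ (t := t)) R r z.1 z.2
  rw [Set.univ_inter, ← evState_eq S (t + 1) t z] at h2
  refine h2.symm.trans ?_
  simp only [evR, funext_iff]

theorem FRprev_eq {R : Finset ℕ} (hD : ∀ d x, 0 < θ.D d x)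
    (h : (S.FR R (t + 1)).rank = nx * nd) :
    S.FRprev R (t + 2) = θ.windowLaw R * θ.stateStep := by
  ext r z
  have h0 : S.P.real (S.evState (t + 1) (t + 1) z) ≠ 0 := by
    have hnd : 0 < nd := z.2.pos
    -- The index `0` stands for duration `1`, where the next duration is redrawn from `D`; since `D`
    -- is positive, every new duration is reached.
    have h1 := real_evState_ne_zero h (z.1, ⟨0, hnd⟩)
    have h2 := real_dur (S := S) (past_univ (t := t)) z.1 ⟨0, hnd⟩ z.2
    rw [Set.univ_inter, ← evState_eq S (t + 1) t (z.1, ⟨0, hnd⟩)] at h2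
    have h3 : 0 < S.P.real (S.evState (t + 1) t (z.1, ⟨0, hnd⟩) ∩ {ω | S.d (t + 1) ω = z.2}) := by
      rw [h2]
      refine mul_pos (lt_of_le_of_ne measureReal_nonneg (Ne.symm h1)) ?_
      simpa [HSMM.dur] using hD z.2 z.1
    refine (h3.trans_le (measureReal_mono ?_)).ne'
    exact fun ω hω => ⟨hω.1.1, hω.2⟩
  have h2 := real_window_prev (S := S) (past_univ (t := t + 1)) R r z.1 z.2
  rw [Set.univ_inter] at h2
  change S.P.real (S.evState (t + 1) (t + 1) z ∩ _) = S.P.real (S.evState (t + 1) (t + 1) z) * _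
    at h2
  rw [FRprev, Matrix.of_apply]
  change (cond S.P (S.evState (t + 1) (t + 1) z)).real _ = _
  rw [real_cond_eq _ (measurableSet_evState S _ _ z), h2, inv_mul_cancel_left₀ h0]

/-! Factorizations of the observable moments. -/

/-- Given `(x_{t+1}, d_t)`, the left window is a past event and the right window is independent of
it. The bound on `L` keeps the indices at least `1`, so natural subtraction does not truncate. -/
theorem MLR_eq {L : Finset ℕ} (hL : ∀ i ∈ L, i + 2 ≤ t + 1) (R : Finset ℕ) :
    S.MLR L R (t + 1) = S.FLjoint L (t + 1) * (θ.windowLaw R)ᵀ := by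
  ext l r
  rw [MLR, Matrix.of_apply, Matrix.mul_apply, ← S.sum_real_inter_evState (t + 1) t]
  refine Finset.sum_congr rfl fun z _ => ?_
  rw [FLjoint, Matrix.of_apply, Matrix.transpose_apply, Set.inter_right_comm, Nat.add_sub_cancel,
    evState_eq, ← Set.inter_assoc, real_window (past_evL hL l)]

theorem MLRo_eq {L : Finset ℕ} (hL : ∀ i ∈ L, i + 2 ≤ t + 1) (R : Finset ℕ) (w : Fin no) :
    S.MLRo L R (t + 1) w = S.FLjoint L (t + 1) * (θ.windowLaw R * θ.emission w)ᵀ := by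
  ext l r
  rw [MLRo, Matrix.of_apply, Matrix.mul_apply, ← S.sum_real_inter_evState (t + 1) t]
  refine Finset.sum_congr rfl fun z _ => ?_
  rw [FLjoint, Matrix.of_apply, Matrix.transpose_apply, HSMM.emission, Matrix.mul_diagonal,
    mul_comm (θ.windowLaw R r z), ← mul_assoc, Nat.add_sub_cancel, evState_eq, ← Set.inter_assoc,
    ← Set.inter_assoc, ← real_emit_window (past_evL hL l)]
  congr 1
  ext ω
  simp only [Set.mem_inter_iff]
  tauto

/-- `durStep` pushes the law of `(x_{t+1}, d_t)` forward to that of `(x_{t+1}, d_{t+1})`. -/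
theorem sum_real_mul_durStep (hA : S.Past t A) (z : Fin nx × Fin nd) :
    ∑ z', S.P.real (A ∩ S.evState (t + 1) t z') * θ.durStep z z' =
      S.P.real (A ∩ {ω | S.x (t + 1) ω = z.1} ∩ {ω | S.d (t + 1) ω = z.2}) := by
  rw [← sum_real_inter_preimage S.P (S.d_meas t), Fintype.sum_prod_type_right]
  refine Finset.sum_congr rfl fun d _ => ?_
  rw [Finset.sum_eq_single z.1]
  · rw [HSMM.durStep, Matrix.of_apply, if_pos rfl, evState_eq, ← Set.inter_assoc, ← real_dur hA]
    congr 1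
    ext ω
    simp only [Set.mem_inter_iff]
    tauto
  · intro x _ hx
    rw [HSMM.durStep, Matrix.of_apply, if_neg hx.symm, mul_zero]
  · simp

theorem MLRnext_eq {L : Finset ℕ} (hL : ∀ i ∈ L, i + 2 ≤ t + 1) (R : Finset ℕ) :
    S.MLRnext L R (t + 1) =
      S.FLjoint L (t + 1) * (θ.windowLaw R * θ.stateStep * θ.durStep)ᵀ := by
  ext l r
  rw [Matrix.transpose_mul, ← Matrix.mul_assoc, MLRnext, Matrix.of_apply, Matrix.mul_apply,
    ← S.sum_real_inter_evState (t + 1) (t + 1)]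
  refine Finset.sum_congr rfl fun z _ => ?_
  have h := sum_real_mul_durStep (past_evL (S := S) hL l) z
  have h' : (S.FLjoint L (t + 1) * θ.durStepᵀ) l z =
      S.P.real (S.evL L (t + 1) l ∩ {ω | S.x (t + 1) ω = z.1} ∩ {ω | S.d (t + 1) ω = z.2}) := by
    rw [← h, Matrix.mul_apply]
    rfl
  rw [h', Matrix.transpose_apply,
    ← real_window_prev ((past_evL (S := S) hL l).mono (Nat.le_succ t))]
  congr 1
  ext ω
  simp only [Set.mem_inter_iff, evState, Set.mem_ofPred_eq]
  tauto

/-- Given `(x_{t+1}, d_{t+1})`, the observation `o_{t+1}` is independent of the future, and its law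
depends on the state only, so the duration can be summed out. -/
theorem Moo_eq (S : HSMMProcess θ Ω) (t : ℕ) :
    S.Moo (t + 1) = S.FnextJoint (t + 1) * θ.Oᵀ := by
  ext v w
  rw [Moo, Matrix.of_apply, Matrix.mul_apply, ← sum_real_inter_preimage S.P (S.x_meas (t + 1))]
  refine Finset.sum_congr rfl fun y _ => ?_
  rw [FnextJoint, Matrix.of_apply, Matrix.transpose_apply,
    ← sum_real_inter_preimage S.P (S.d_meas (t + 1)),
    ← sum_real_inter_preimage S.P (S.d_meas (t + 1)) (_ ∩ {ω | S.x (t + 1) ω = y}),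
    Finset.sum_mul]
  refine Finset.sum_congr rfl fun e _ => ?_
  have hev : S.evO (t + 1 + 1) v =
      {ω | ∀ j < 1, S.o (t + 1 + 1 + j) ω ∈ ({v} : Finset (Fin no))} := by
    ext ω
    simp [evO]
  have h1 := real_future (S := S) (past_o (Nat.succ_pos t) w) 1 (fun _ => {v}) y e
  have h2 := real_future (S := S) (past_univ (t := t + 1)) 1 (fun _ => {v}) y e
  have h3 := real_emit_state (S := S) (past_univ (t := t)) y e w
  rw [← hev] at h1 h2
  calc _ = S.P.real (S.evO (t + 1) w ∩ {ω | S.x (t + 1) ω = y} ∩ {ω | S.d (t + 1) ω = e} ∩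
        S.evO (t + 1 + 1) v) := by
        congr 1
        ext ω
        simp only [Set.mem_inter_iff]
        tauto
    _ = S.P.real (Set.univ ∩ {ω | S.x (t + 1) ω = y} ∩ {ω | S.d (t + 1) ω = e} ∩
        S.evO (t + 1 + 1) v) * θ.O w y := by
        rw [h1, h2, mul_right_comm, ← h3]
        congr 2
        ext ω
        simp only [Set.mem_inter_iff, Set.mem_univ, true_and]
        tauto
    _ = _ := by
        congr 2
        ext ω
        simp only [Set.mem_inter_iff, Set.mem_univ, true_and]
        tauto

/-- Passes from the conditional rank condition at a fixed time to the joint one used in the pooled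
forms. -/
theorem rank_FLjoint {L : Finset ℕ} (h : (S.FL L t).rank = nx * nd) :
    (S.FLjoint L t).rank = nx * nd := by
  have h' := rank_eq_card_of_scaled (A := S.FL L t) (B := S.FLjoint L t)
    (c := fun z => S.P.real (S.evState t (t - 1) z)) (by simpa using h) ?_ ?_
  · simpa using h'
  · intro l z
    rw [FLjoint, FL, Matrix.of_apply, Matrix.of_apply,
      real_cond_mul _ (measurableSet_evState S t (t - 1) z), Set.inter_comm]
  · intro z hz l
    rw [FL, Matrix.of_apply, real_cond_eq _ (measurableSet_evState S t (t - 1) z), hz, inv_zero,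
      zero_mul]

theorem rank_FnextJoint (h : (S.Fnext t).rank = nx) : (S.FnextJoint t).rank = nx := by
  have hm : ∀ y, MeasurableSet {ω | S.x t ω = y} := fun y => S.x_meas t (measurableSet_singleton y)
  have h' := rank_eq_card_of_scaled (A := S.Fnext t) (B := S.FnextJoint t)
    (c := fun y => S.P.real {ω | S.x t ω = y}) (by simpa using h) ?_ ?_
  · simpa using h'
  · intro v y
    rw [FnextJoint, Fnext, Matrix.of_apply, Matrix.of_apply, real_cond_mul _ (hm y), Set.inter_comm]
  · intro y hy v
    rw [Fnext, Matrix.of_apply, real_cond_eq _ (hm y), hy, inv_zero, zero_mul]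

end HSMMProcess

/-! ### Tensors as conjugated forward operators, and the product representation. -/

namespace HSMMProcess

variable {nx nd no : ℕ} {θ : HSMM nx nd no} {Ω : Type*} [MeasurableSpace Ω]
  {S : HSMMProcess θ Ω} {R : Finset ℕ} {t : ℕ}

/-! The transformed tensors in terms of the window law. -/

theorem Otilde_eq (θ : HSMM nx nd no) : Otilde θ = (θ.O * pinv θ.O)ᵀ := by
  ext v w
  rw [Otilde, Matrix.of_apply, Matrix.transpose_apply, Matrix.mul_apply]
  exact Finset.sum_congr rfl fun x _ => mul_comm _ _

/-- The Penrose equation `O O⁺ O = O`: contracting an emission mode with `Õ|_u` evaluates it at `u`.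
-/
theorem sum_O_mul_Otilde (x : Fin nx) (u : Fin no) :
    ∑ v, θ.O v x * Otilde θ v u = θ.O u x := by
  have h := congrFun (congrFun (pinv_spec θ.O).mul_mul_left u) x
  rw [Matrix.mul_apply] at h
  rw [← h, Otilde_eq]
  exact Finset.sum_congr rfl fun v _ => mul_comm _ _

theorem Dtilde_eq (hG : S.FR R (t + 2) = θ.windowLaw R)
    (hF : S.FRprev R (t + 3) = θ.windowLaw R * θ.stateStep) :
    S.Dtilde R (t + 3) =
      (θ.windowLaw R * θ.stateStep * θ.durStep * pinv (θ.windowLaw R))ᵀ := by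
  ext q r
  rw [Dtilde, Matrix.of_apply, Matrix.transpose_apply, Matrix.mul_apply, Fintype.sum_prod_type,
    show t + 3 - 1 = t + 2 from rfl, hG, hF]
  refine Finset.sum_congr rfl fun x _ => Finset.sum_congr rfl fun d _ => ?_
  rw [mul_comm (pinv _ _ _)]
  congr 1
  rw [Matrix.mul_apply (M := θ.windowLaw R * θ.stateStep), Fintype.sum_prod_type,
    Finset.sum_eq_single x]
  · simp [HSMM.durStep, mul_comm]
  · intro y _ hy
    simp [HSMM.durStep, hy]
  · simp

theorem sum_trans_mul (f : Fin nx → ℝ) (r : R → Fin no) (x : Fin nx) (d : Fin nd) :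
    ∑ y, θ.trans y x d * f y * θ.windowLaw R r (y, d) =
      (θ.windowLaw R * Matrix.diagonal (fun z : Fin nx × Fin nd => f z.1) * θ.stateStep)
        r (x, d) := by
  rw [Matrix.mul_apply, Fintype.sum_prod_type]
  refine Finset.sum_congr rfl fun y _ => ?_
  simp [HSMM.stateStep, Matrix.mul_diagonal]
  ring

/-- The definition gives `G E_w K (G K)⁺`. Since `(G K)⁺ = K⁻¹ G⁺`, the state transition cancels and
only the emission remains. -/
theorem Xtilde_eq (hX : θ.X.rank = nx) (hG' : pinv (θ.windowLaw R) * θ.windowLaw R = 1)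
    (hG : S.FR R (t + 3) = θ.windowLaw R)
    (hF : S.FRprev R (t + 3) = θ.windowLaw R * θ.stateStep) (w : Fin no) :
    S.Xtilde R (t + 3) w = (θ.windowLaw R * θ.emission w * pinv (θ.windowLaw R))ᵀ := by
  have hK := θ.isUnit_stateStep hX
  have h1 : θ.windowLaw R * θ.emission w * pinv (θ.windowLaw R) =
      θ.windowLaw R * θ.emission w * θ.stateStep * pinv (θ.windowLaw R * θ.stateStep) := by
    rw [pinv_mul_of_isUnit hG' hK, Matrix.mul_assoc (_ * _) θ.stateStep,
      ← Matrix.mul_assoc θ.stateStep,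
      Matrix.mul_nonsing_inv _ ((Matrix.isUnit_iff_isUnit_det _).1 hK), Matrix.one_mul]
  rw [h1]
  ext q r
  rw [Xtilde, Matrix.of_apply, Matrix.transpose_apply, Matrix.mul_apply, Fintype.sum_prod_type,
    hG, hF]
  refine Finset.sum_congr rfl fun x _ => Finset.sum_congr rfl fun d _ => ?_
  rw [mul_comm (pinv _ _ _), sum_trans_mul (fun y => θ.O w y)]
  rfl

theorem Xfinal_eq_sum (h1 : ∀ z, ∑ r, S.FR R t r z = 1) (w : Fin no) (q : R → Fin no) :
    S.Xfinal R t w q = ∑ r, S.Xtilde R t w q r := by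
  simp only [Xfinal, Xtilde, Matrix.of_apply]
  refine Eq.trans (Finset.sum_congr rfl fun x _ => ?_) Finset.sum_comm.symm
  refine Eq.trans (Finset.sum_congr rfl fun d _ => ?_) Finset.sum_comm.symm
  rw [← Finset.mul_sum, Finset.sum_comm (s := Finset.univ (α := R → Fin no))]
  congr 1
  refine Finset.sum_congr rfl fun y _ => ?_
  rw [← Finset.mul_sum, h1, mul_one]

theorem sum_Otilde_smul_Xtilde
    (hX : ∀ w, S.Xtilde R t w = (θ.windowLaw R * θ.emission w * pinv (θ.windowLaw R))ᵀ)
    (u : Fin no) : ∑ w, Otilde θ w u • S.Xtilde R t w =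
      (θ.windowLaw R * θ.emission u * pinv (θ.windowLaw R))ᵀ := by
  have h : θ.emission u = ∑ w, Otilde θ w u • (θ.emission w : Matrix (Fin nx × Fin nd) _ ℝ) := by
    ext z z'
    simp only [Matrix.sum_apply, Matrix.smul_apply, HSMM.emission, smul_eq_mul]
    by_cases hz : z = z'
    · subst hz
      simp only [Matrix.diagonal_apply_eq]
      rw [← sum_O_mul_Otilde]
      exact Finset.sum_congr rfl fun v _ => mul_comm _ _
    · simp [hz]
  rw [h]
  simp only [hX, Matrix.mul_sum, Matrix.sum_mul, Matrix.transpose_sum, Matrix.mul_smul,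
    Matrix.smul_mul, Matrix.transpose_smul]

/-! The forward recursion. -/

theorem evObs_succ (S : HSMMProcess θ Ω) (u : ℕ → Fin no) (t : ℕ) :
    S.evObs u (t + 1) = S.evObs u t ∩ S.evO (t + 1) (u (t + 1)) := by
  ext ω
  simp only [evObs, evO, Set.mem_inter_iff, Set.mem_ofPred_eq, Finset.mem_Icc]
  constructor
  · exact fun h => ⟨fun i hi => h i ⟨hi.1, by omega⟩, h _ ⟨by omega, le_rfl⟩⟩
  · rintro ⟨h, h'⟩ i hi
    by_cases hit : i = t + 1
    · rw [hit, h']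
    · exact h i ⟨hi.1, by omega⟩

/-- The joint probability of the first `t` observations and the state and duration at time `t`. -/
noncomputable def forward (S : HSMMProcess θ Ω) (u : ℕ → Fin no) (t : ℕ)
    (z : Fin nx × Fin nd) : ℝ :=
  S.P.real (S.evObs u t ∩ {ω | S.x t ω = z.1} ∩ {ω | S.d t ω = z.2})

/-- The joint probability of the first `t` observations, the state at time `t` and the previous
duration. -/
noncomputable def forwardPrev (S : HSMMProcess θ Ω) (u : ℕ → Fin no) (t : ℕ)
    (z : Fin nx × Fin nd) : ℝ :=
  S.P.real (S.evObs u t ∩ S.evState t (t - 1) z)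

/-- A time step is split in two: the state moves with the old duration and emits here; the duration
moves in `forward_succ`. -/
theorem forwardPrev_succ (S : HSMMProcess θ Ω) (u : ℕ → Fin no) (t : ℕ) :
    S.forwardPrev u (t + 1) =
      (θ.emission (u (t + 1)) * θ.stateStep) *ᵥ S.forward u t := by
  funext z
  rw [HSMM.emission, ← Matrix.mulVec_mulVec, Matrix.mulVec_diagonal, Matrix.mulVec, dotProduct,
    forwardPrev, evObs_succ, Nat.add_sub_cancel, evState_eq, Set.inter_right_comm,
    ← Set.inter_assoc, real_emit (S := S) (past_evObs u), mul_comm,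
    ← sum_real_inter_preimage S.P (S.x_meas t)]
  congr 1
  rw [Fintype.sum_prod_type]
  refine Finset.sum_congr rfl fun x _ => ?_
  rw [Finset.sum_eq_single z.2]
  · rw [HSMM.stateStep, Matrix.of_apply, if_pos rfl, forward, mul_comm,
      ← real_trans (S := S) (past_evObs u)]
    congr 1
    ext ω
    simp only [Set.mem_inter_iff]
    tauto
  · intro d _ hd
    rw [HSMM.stateStep, Matrix.of_apply, if_neg hd.symm, zero_mul]
  · simp

theorem forward_succ (S : HSMMProcess θ Ω) (u : ℕ → Fin no) (t : ℕ) :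
    S.forward u (t + 1) = θ.durStep *ᵥ S.forwardPrev u (t + 1) := by
  funext z
  have h := sum_real_mul_durStep (S := S) (past_evObs (S := S) (t := t) u) z
  have h' := real_emit_state (S := S) (past_evObs (S := S) (t := t) u) z.1 z.2 (u (t + 1))
  rw [forward, evObs_succ, Set.inter_right_comm _ (S.evO _ _), Set.inter_right_comm _ (S.evO _ _)]
  refine h'.trans ?_
  rw [← h, Finset.sum_mul, Matrix.mulVec, dotProduct]
  refine Finset.sum_congr rfl fun z' _ => ?_
  rw [forwardPrev, evObs_succ, Set.inter_right_comm, Nat.add_sub_cancel, evState_eq,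
    ← Set.inter_assoc, real_emit (S := S) (past_evObs u), mul_right_comm, mul_comm (θ.durStep z z')]
  -- `durStep` preserves the state, so the emission factor may be evaluated on either side of it.
  by_cases hz : z.1 = z'.1
  · rw [hz]
  · rw [HSMM.durStep, Matrix.of_apply, if_neg hz, mul_zero, mul_zero]

theorem sum_forwardPrev (S : HSMMProcess θ Ω) (u : ℕ → Fin no) (t : ℕ) :
    ∑ z, S.forwardPrev u t z = S.P.real (S.evObs u t) :=
  S.sum_real_inter_evState t (t - 1) _

theorem forward_one (S : HSMMProcess θ Ω) (u : ℕ → Fin no) (z : Fin nx × Fin nd) :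
    S.forward u 1 z = S.P.real (S.evState 1 1 z) * θ.O (u 1) z.1 := by
  have h := real_emit_state (S := S) (past_univ (t := 0)) z.1 z.2 (u 1)
  rw [Set.univ_inter] at h
  refine Eq.trans ?_ h
  rw [forward]
  congr 1
  ext ω
  simp only [evObs, evO, Set.mem_inter_iff, Set.mem_ofPred_eq, Finset.Icc_self,
    Finset.mem_singleton, forall_eq]
  tauto

/-- The initial tensor is an observable moment. -/
theorem Xroot_eq (hG : S.FR R 2 = θ.windowLaw R) (v w : Fin no) (r : R → Fin no) :
    S.Xroot R v w r = S.P.real (S.evO 1 v ∩ S.evO 2 w ∩ S.evR R 2 r) := by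
  rw [Xroot, hG]
  refine Eq.trans (Finset.sum_congr rfl fun x _ => ?_)
    (sum_real_inter_preimage S.P (S.x_meas 1) _)
  refine Eq.trans (Finset.sum_congr rfl fun d _ => ?_)
    (sum_real_inter_preimage S.P (S.d_meas 1) _)
  rw [Finset.mul_sum]
  refine Eq.trans (Finset.sum_congr rfl fun y _ => ?_)
    (sum_real_inter_preimage S.P (S.x_meas 2) _)
  have hv : S.Past 1 (S.evO 1 v) := past_o le_rfl v
  have h0 := real_emit_state (S := S) (past_univ (t := 0)) x d v
  have h1 := real_trans hv x y d
  have h2 := real_emit_window (hv.inter (past_x x)) R r y d w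
  rw [h1] at h2
  have h3 : S.P.real (S.evO 1 v ∩ {ω | S.x 1 ω = x} ∩ {ω | S.d 1 ω = d}) =
      S.P.real (S.evState 1 1 (x, d)) * θ.O v x := by
    rw [Set.univ_inter] at h0
    refine Eq.trans ?_ h0
    rw [Set.inter_assoc, Set.inter_comm]
  rw [← h3, ← mul_assoc, ← mul_assoc, ← h2]
  congr 1
  ext ω
  simp only [Set.mem_inter_iff]
  tauto

theorem tensorProd_zero (hG : S.FR R 2 = θ.windowLaw R) (u : ℕ → Fin no) :
    S.tensorProd R u 0 = θ.windowLaw R *ᵥ S.forwardPrev u 2 := by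
  funext r
  have h1 : ∀ x d, S.forward u 1 (x, d) = S.P.real (S.evState 1 1 (x, d)) *
      ∑ v, θ.O v x * Otilde θ v (u 1) := fun x d => by
    rw [sum_O_mul_Otilde]
    exact S.forward_one u (x, d)
  have h2 : ∀ x d, (θ.windowLaw R * θ.emission (u 2) * θ.stateStep) r (x, d) =
      ∑ y, θ.trans y x d * (∑ w, θ.O w y * Otilde θ w (u 2)) * θ.windowLaw R r (y, d) :=
    fun x d => by
      simp only [sum_O_mul_Otilde]
      exact (sum_trans_mul (fun y => θ.O (u 2) y) r x d).symm
  rw [forwardPrev_succ, Matrix.mulVec_mulVec, ← Matrix.mul_assoc, Matrix.mulVec, dotProduct,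
    Fintype.sum_prod_type]
  simp only [tensorProd, Xroot, hG, h1, h2]
  have h3 : ∀ v w, (∑ x, ∑ d, S.P.real (S.evState 1 1 (x, d)) * θ.O v x *
        ∑ y, θ.trans y x d * θ.O w y * θ.windowLaw R r (y, d)) * Otilde θ v (u 1) *
          Otilde θ w (u 2) =
      ∑ x, ∑ d, ∑ y, S.P.real (S.evState 1 1 (x, d)) * θ.O v x *
        (θ.trans y x d * θ.O w y * θ.windowLaw R r (y, d)) * Otilde θ v (u 1) *
          Otilde θ w (u 2) := fun v w => by
    simp only [Finset.mul_sum, Finset.sum_mul]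
  simp only [h3]
  -- The sums over the symbols `v`, `w` are moved inside those over `x` and `d`, where they split
  -- into the two contractions with `Õ`.
  refine (Finset.sum_congr rfl fun v _ => Finset.sum_comm).trans (Finset.sum_comm.trans ?_)
  refine Finset.sum_congr rfl fun x _ => ?_
  refine (Finset.sum_congr rfl fun v _ => Finset.sum_comm).trans (Finset.sum_comm.trans ?_)
  refine Finset.sum_congr rfl fun d _ => ?_
  rw [mul_comm, mul_assoc, Finset.sum_mul, Finset.mul_sum]
  refine Finset.sum_congr rfl fun v _ => ?_
  rw [Finset.sum_comm]
  simp only [Finset.mul_sum, Finset.sum_mul]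
  refine Finset.sum_congr rfl fun y _ => Finset.sum_congr rfl fun w _ => ?_
  ring

/-- Two inner factors `G⁺ G = 1` cancel, leaving `G` times one step of the forward recursion. -/
theorem vecMul_Dtilde (hG' : pinv (θ.windowLaw R) * θ.windowLaw R = 1)
    (hD : S.Dtilde R (t + 1) =
      (θ.windowLaw R * θ.stateStep * θ.durStep * pinv (θ.windowLaw R))ᵀ)
    (hX : ∀ w, S.Xtilde R (t + 1) w = (θ.windowLaw R * θ.emission w * pinv (θ.windowLaw R))ᵀ)
    (hs : 1 ≤ t) (u : ℕ → Fin no) :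
    ((θ.windowLaw R *ᵥ S.forwardPrev u t) ᵥ* S.Dtilde R (t + 1)) ᵥ*
        ∑ w, Otilde θ w (u (t + 1)) • S.Xtilde R (t + 1) w =
      θ.windowLaw R *ᵥ S.forwardPrev u (t + 1) := by
  obtain ⟨s, rfl⟩ := Nat.exists_eq_add_of_le' hs
  rw [sum_Otilde_smul_Xtilde hX, hD, Matrix.vecMul_transpose, Matrix.vecMul_transpose,
    S.forwardPrev_succ u (s + 1), forward_succ]
  simp only [Matrix.mulVec_mulVec]
  congr 1
  calc _ = θ.windowLaw R * θ.emission (u (s + 1 + 1)) *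
        (pinv (θ.windowLaw R) * θ.windowLaw R) * θ.stateStep * θ.durStep *
          (pinv (θ.windowLaw R) * θ.windowLaw R) := by simp only [Matrix.mul_assoc]
    _ = _ := by simp only [hG', Matrix.mul_one, Matrix.mul_assoc]

theorem tensorProd_eq (hG' : pinv (θ.windowLaw R) * θ.windowLaw R = 1)
    (hG : S.FR R 2 = θ.windowLaw R)
    (hD : ∀ k, S.Dtilde R (k + 3) =
      (θ.windowLaw R * θ.stateStep * θ.durStep * pinv (θ.windowLaw R))ᵀ)
    (hX : ∀ k w, S.Xtilde R (k + 3) w =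
      (θ.windowLaw R * θ.emission w * pinv (θ.windowLaw R))ᵀ) (u : ℕ → Fin no) (k : ℕ) :
    S.tensorProd R u k = θ.windowLaw R *ᵥ S.forwardPrev u (k + 2) := by
  induction k with
  | zero => exact tensorProd_zero hG u
  | succ k ih =>
    rw [tensorProd, ih]
    exact vecMul_Dtilde hG' (hD k) (hX k) (by omega) u

end HSMMProcess

namespace HSMMProcess

variable {nx nd no : ℕ} {θ : HSMM nx nd no} {Ω : Type*} [MeasurableSpace Ω]
  {S : HSMMProcess θ Ω} {L R : Finset ℕ}

/-! Pooled observable forms. -/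

/-- The right factors of the moments are common to all `s ∈ I` and come out of the sums, so only the
pooled left factor needs full column rank. -/
theorem pooled_Dtilde (hG' : pinv (θ.windowLaw R) * θ.windowLaw R = 1) {I : Finset ℕ}
    (hI : ∀ s ∈ I, 3 ≤ s ∧ ∀ i ∈ L, i + 2 ≤ s - 1)
    (hr : (∑ s ∈ I, S.FLjoint L (s - 1)).rank = nx * nd) :
    pinv (∑ s ∈ I, S.MLR L R (s - 1)) * ∑ s ∈ I, S.MLRnext L R (s - 1) =
      (θ.windowLaw R * θ.stateStep * θ.durStep * pinv (θ.windowLaw R))ᵀ := by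
  have hJ := pinv_mul_self_of_rank_eq_card (A := ∑ s ∈ I, S.FLjoint L (s - 1)) (by simpa using hr)
  have h1 : ∀ s ∈ I, S.MLR L R (s - 1) = S.FLjoint L (s - 1) * (θ.windowLaw R)ᵀ := by
    intro s hs
    obtain ⟨h3, hL⟩ := hI s hs
    obtain ⟨t, rfl⟩ := Nat.exists_eq_add_of_le' (show 2 ≤ s by omega)
    exact MLR_eq hL R
  have h2 : ∀ s ∈ I, S.MLRnext L R (s - 1) =
      S.FLjoint L (s - 1) * (θ.windowLaw R * θ.stateStep * θ.durStep)ᵀ := by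
    intro s hs
    obtain ⟨h3, hL⟩ := hI s hs
    obtain ⟨t, rfl⟩ := Nat.exists_eq_add_of_le' (show 2 ≤ s by omega)
    exact MLRnext_eq hL R
  rw [Finset.sum_congr rfl h1, Finset.sum_congr rfl h2, ← Matrix.sum_mul, ← Matrix.sum_mul,
    pinv_mul_transpose hJ hG', Matrix.mul_assoc, ← Matrix.mul_assoc (pinv _), hJ, Matrix.one_mul,
    ← Matrix.transpose_mul]

theorem pooled_Xtilde (hG' : pinv (θ.windowLaw R) * θ.windowLaw R = 1) {I : Finset ℕ}
    (hI : ∀ s ∈ I, 3 ≤ s ∧ ∀ i ∈ L, i + 2 ≤ s)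
    (hr : (∑ s ∈ I, S.FLjoint L s).rank = nx * nd) (w : Fin no) :
    pinv (∑ s ∈ I, S.MLR L R s) * ∑ s ∈ I, S.MLRo L R s w =
      (θ.windowLaw R * θ.emission w * pinv (θ.windowLaw R))ᵀ := by
  have hJ := pinv_mul_self_of_rank_eq_card (A := ∑ s ∈ I, S.FLjoint L s) (by simpa using hr)
  have h1 : ∀ s ∈ I, S.MLR L R s = S.FLjoint L s * (θ.windowLaw R)ᵀ := by
    intro s hs
    obtain ⟨h3, hL⟩ := hI s hs
    obtain ⟨t, rfl⟩ := Nat.exists_eq_add_of_le' (show 1 ≤ s by omega)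
    exact MLR_eq hL R
  have h2 : ∀ s ∈ I, S.MLRo L R s w = S.FLjoint L s * (θ.windowLaw R * θ.emission w)ᵀ := by
    intro s hs
    obtain ⟨h3, hL⟩ := hI s hs
    obtain ⟨t, rfl⟩ := Nat.exists_eq_add_of_le' (show 1 ≤ s by omega)
    exact MLRo_eq hL R w
  rw [Finset.sum_congr rfl h1, Finset.sum_congr rfl h2, ← Matrix.sum_mul, ← Matrix.sum_mul,
    pinv_mul_transpose hJ hG', Matrix.mul_assoc, ← Matrix.mul_assoc (pinv _), hJ, Matrix.one_mul,
    ← Matrix.transpose_mul]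

theorem pooled_Otilde (hO : θ.O.rank = nx) {I : Finset ℕ} (hI : ∀ s ∈ I, 1 ≤ s)
    (hr : (∑ s ∈ I, S.FnextJoint s).rank = nx) :
    pinv (∑ s ∈ I, S.Moo s) * ∑ s ∈ I, S.Moo s = Otilde θ := by
  have hJ := pinv_mul_self_of_rank_eq_card (A := ∑ s ∈ I, S.FnextJoint s) (by simpa using hr)
  have hO' := pinv_mul_self_of_rank_eq_card (A := θ.O) (by simpa using hO)
  have h1 : ∀ s ∈ I, S.Moo s = S.FnextJoint s * θ.Oᵀ := by
    intro s hs
    obtain ⟨t, rfl⟩ := Nat.exists_eq_add_of_le' (hI s hs)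
    exact S.Moo_eq t
  rw [Finset.sum_congr rfl h1, ← Matrix.sum_mul, pinv_mul_transpose hJ hO', Matrix.mul_assoc,
    ← Matrix.mul_assoc (pinv _), hJ, Matrix.one_mul, ← Matrix.transpose_mul, Otilde_eq]

end HSMMProcess

/-! ### Assembly of the conclusions. -/

theorem mainTheorem6 {nx nd no : ℕ} (θ : HSMM nx nd no) (hθ : θ.Regular)
    {Ω : Type*} [MeasurableSpace Ω] (S : HSMMProcess θ Ω) (L R : Finset ℕ)
    -- rank condition on the right windows
    (hR : ∀ t, 2 ≤ t → (S.FR R t).rank = nx * nd) :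
    -- the joint probability is a product of transformed tensors
    (∀ (u : ℕ → Fin no) (T : ℕ), 3 ≤ T →
      S.P.real {ω | ∀ t ∈ Finset.Icc 1 T, S.o t ω = u t} =
        (S.tensorProd R u (T - 3) ᵥ* S.Dtilde R T) ⬝ᵥ
          (∑ w, HSMMProcess.Otilde θ w (u T) • S.Xfinal R T w)) ∧
    (∀ (u : ℕ → Fin no) (T : ℕ), 2 ≤ T →
      S.P.real {ω | ∀ t ∈ Finset.Icc 1 T, S.o t ω = u t} = ∑ r, S.tensorProd R u (T - 2) r) ∧
    -- the initial tensor is an observable moment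
    (∀ v w r, S.Xroot R v w r = S.P.real (S.evO 1 v ∩ S.evO 2 w ∩ S.evR R 2 r)) ∧
    -- the final tensor is a marginal of the general one
    (∀ t, 3 ≤ t → ∀ w q, S.Xfinal R t w q = ∑ r, S.Xtilde R t w q r) ∧
    -- homogeneity of the transformed tensors
    (∀ t, 3 ≤ t → S.Dtilde R t = S.Dtilde R 3 ∧ ∀ w, S.Xtilde R t w = S.Xtilde R 3 w) ∧
    -- observable forms at a fixed time
    (∀ t, 3 ≤ t → (∀ i ∈ L, i + 2 ≤ t - 1) → (S.FL L (t - 1)).rank = nx * nd →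
      S.Dtilde R t = pinv (S.MLR L R (t - 1)) * S.MLRnext L R (t - 1)) ∧
    (∀ t, 3 ≤ t → (∀ i ∈ L, i + 2 ≤ t) → (S.FL L t).rank = nx * nd →
      ∀ w, S.Xtilde R t w = pinv (S.MLR L R t) * S.MLRo L R t w) ∧
    (∀ t, 1 ≤ t → (S.Fnext t).rank = nx →
      HSMMProcess.Otilde θ = pinv (S.Moo t) * S.Moo t) ∧
    -- pooled observable forms
    (∀ I : Finset ℕ, (∀ s ∈ I, 3 ≤ s ∧ ∀ i ∈ L, i + 2 ≤ s - 1) →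
      (∑ s ∈ I, S.FLjoint L (s - 1)).rank = nx * nd →
      ∀ t, 3 ≤ t → S.Dtilde R t =
        pinv (∑ s ∈ I, S.MLR L R (s - 1)) * ∑ s ∈ I, S.MLRnext L R (s - 1)) ∧
    (∀ I : Finset ℕ, (∀ s ∈ I, 3 ≤ s ∧ ∀ i ∈ L, i + 2 ≤ s) →
      (∑ s ∈ I, S.FLjoint L s).rank = nx * nd →
      ∀ t, 3 ≤ t → ∀ w, S.Xtilde R t w =
        pinv (∑ s ∈ I, S.MLR L R s) * ∑ s ∈ I, S.MLRo L R s w) ∧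
    (∀ I : Finset ℕ, (∀ s ∈ I, 1 ≤ s) →
      (∑ s ∈ I, S.FnextJoint s).rank = nx →
      HSMMProcess.Otilde θ = pinv (∑ s ∈ I, S.Moo s) * ∑ s ∈ I, S.Moo s) := by
  have hG2 : ∀ t, S.FR R (t + 2) = θ.windowLaw R :=
    fun t => HSMMProcess.FR_eq_windowLaw (hR (t + 2) (by omega))
  have hF : ∀ t, S.FRprev R (t + 3) = θ.windowLaw R * θ.stateStep :=
    fun t => HSMMProcess.FRprev_eq hθ.D_pos (hR (t + 2) (by omega))
  have hG' : pinv (θ.windowLaw R) * θ.windowLaw R = 1 := by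
    rw [← hG2 0]
    exact pinv_mul_self_of_rank_eq_card (by simpa using hR 2 le_rfl)
  have hsum : ∀ z, ∑ r, θ.windowLaw R r z = 1 :=
    fun z => HSMMProcess.sum_windowLaw (hR 2 le_rfl) z
  have hD := fun t => HSMMProcess.Dtilde_eq (S := S) (hG2 t) (hF t)
  have hX := fun t => HSMMProcess.Xtilde_eq (S := S) hθ.X_rank hG' (hG2 (t + 1)) (hF t)
  have hfin : ∀ t, 3 ≤ t → ∀ w q, S.Xfinal R t w q = ∑ r, S.Xtilde R t w q r := by
    intro t ht w q
    obtain ⟨t, rfl⟩ := Nat.exists_eq_add_of_le' ht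
    exact HSMMProcess.Xfinal_eq_sum (fun z => by rw [hG2 (t + 1)]; exact hsum z) w q
  have hprod : ∀ (u : ℕ → Fin no) (T : ℕ), 2 ≤ T →
      S.P.real {ω | ∀ t ∈ Finset.Icc 1 T, S.o t ω = u t} = ∑ r, S.tensorProd R u (T - 2) r := by
    intro u T hT
    obtain ⟨k, rfl⟩ := Nat.exists_eq_add_of_le' hT
    rw [Nat.add_sub_cancel, HSMMProcess.tensorProd_eq hG' (hG2 0) hD hX]
    refine (S.sum_forwardPrev u (k + 2)).symm.trans ?_
    simp only [Matrix.mulVec, dotProduct]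
    rw [Finset.sum_comm]
    simp only [← Finset.sum_mul, hsum, one_mul]
  have hDpool : ∀ I : Finset ℕ, (∀ s ∈ I, 3 ≤ s ∧ ∀ i ∈ L, i + 2 ≤ s - 1) →
      (∑ s ∈ I, S.FLjoint L (s - 1)).rank = nx * nd →
      ∀ t, 3 ≤ t → S.Dtilde R t =
        pinv (∑ s ∈ I, S.MLR L R (s - 1)) * ∑ s ∈ I, S.MLRnext L R (s - 1) := by
    intro I hI hr t ht
    obtain ⟨t, rfl⟩ := Nat.exists_eq_add_of_le' ht
    rw [hD, HSMMProcess.pooled_Dtilde hG' hI hr]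
  have hXpool : ∀ I : Finset ℕ, (∀ s ∈ I, 3 ≤ s ∧ ∀ i ∈ L, i + 2 ≤ s) →
      (∑ s ∈ I, S.FLjoint L s).rank = nx * nd →
      ∀ t, 3 ≤ t → ∀ w, S.Xtilde R t w =
        pinv (∑ s ∈ I, S.MLR L R s) * ∑ s ∈ I, S.MLRo L R s w := by
    intro I hI hr t ht w
    obtain ⟨t, rfl⟩ := Nat.exists_eq_add_of_le' ht
    rw [hX, HSMMProcess.pooled_Xtilde hG' hI hr]
  have hOpool : ∀ I : Finset ℕ, (∀ s ∈ I, 1 ≤ s) →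
      (∑ s ∈ I, S.FnextJoint s).rank = nx →
      HSMMProcess.Otilde θ = pinv (∑ s ∈ I, S.Moo s) * ∑ s ∈ I, S.Moo s :=
    fun I hI hr => (HSMMProcess.pooled_Otilde hθ.O_rank hI hr).symm
  refine ⟨?_, hprod, HSMMProcess.Xroot_eq (hG2 0), hfin, ?_, ?_, ?_, ?_, hDpool, hXpool, hOpool⟩
  · intro u T hT
    rw [hprod u T (by omega)]
    obtain ⟨k, rfl⟩ := Nat.exists_eq_add_of_le' hT
    -- The final factor is the general one applied to the all-ones vector, so this representation is
    -- the summed one.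
    have h : ∑ w, HSMMProcess.Otilde θ w (u (k + 3)) • S.Xfinal R (k + 3) w =
        (∑ w, HSMMProcess.Otilde θ w (u (k + 3)) • S.Xtilde R (k + 3) w) *ᵥ 1 := by
      funext q
      simp only [Finset.sum_apply, Pi.smul_apply, hfin (k + 3) hT, Matrix.mulVec, dotProduct,
        Pi.one_apply, mul_one, Matrix.sum_apply, Matrix.smul_apply]
      rw [Finset.sum_comm]
      simp only [Finset.smul_sum]
    rw [h, Matrix.dotProduct_mulVec, dotProduct_one]
    rfl
  · intro t ht
    obtain ⟨t, rfl⟩ := Nat.exists_eq_add_of_le' ht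
    exact ⟨(hD t).trans (hD 0).symm, fun w => (hX t w).trans (hX 0 w).symm⟩
  · intro t ht hL hr
    -- The fixed-time forms are the pooled ones for a single time.
    have h := hDpool {t} (by simpa using ⟨ht, hL⟩)
      (by simpa using HSMMProcess.rank_FLjoint hr) t ht
    simpa using h
  · intro t ht hL hr w
    have h := hXpool {t} (by simpa using ⟨ht, hL⟩)
      (by simpa using HSMMProcess.rank_FLjoint hr) t ht w
    simpa using h
  · intro t ht hr
    have h := hOpool {t} (by simpa using ht) (by simpa using HSMMProcess.rank_FnextJoint hr)
    simpa using h
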